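/- Let $d\in\{2,3\}$, let $\mathcal D\subset\mathbb R^d$ be a (nonempty, open) convex bounded polyhedron, let $T>0$, let $V\in L^\infty(\mathcal D;\mathbb R)$ with $V\ge 0$ almost everywhere, and let $\gamma:[0,\infty)\to[0,\infty)$ be a smooth function with $\gamma(0)=0$ such that for some function $L$ and some constants $C$ and $q\ge 0$ (with $q<2$ if $d=3$) $$\big|\gamma(|v|^2)v-\gamma(|w|^2)w\big|\le L(K)\,|v-w|\quad\text{for all } v,w\in\mathbb C \text{ with } |v|,|w|\le K,\qquad 0\le L(s)\le C s^q\quad\text{for all } s\ge 0 .$$ All function spaces consist of complex-valued functions, and $\langle f,g\rangle_{L^2(\mathcal D)}=\int_{\mathcal D} f\,\overline g$. Let $u^0\in H^1_0(\mathcal D)$. A solution of the nonlinear Schrödinger equation $i\partial_t u=-\Delta u+Vu+\gamma(|u|^2)u$ with initial value $u^0$ is a function $u\in L^\infty([0,T],H^1_0(\mathcal D))$ with $\partial_t u\in L^\infty([0,T],H^{-1}(\mathcal D))$ such that $u(\cdot,0)=u^0$ (this is meaningful, since such $u$ belongs to $C^0([0,T],L^2(\mathcal D))$) and $$ i\langle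 \partial_t u(\cdot,t),w\rangle_{H^{-1},H^1_0}=\langle\nabla u(\cdot,t),\nabla w\rangle_{L^2(\mathcal D)}+\langle V u(\cdot,t),w\rangle_{L^2(\mathcal D)}+\langle\gamma(|u(\cdot,t)|^2)u(\cdot,t),w\rangle_{L^2(\mathcal D)}$$ for all $w\in H^1_0(\mathcal D)$ and almost every $t\in(0,T]$. Let $u^{(1)}$ and $u^{(2)}$ be two such solutions, with the same data $V,\gamma,T,u^0$, and suppose that both satisfy $$u\in C^0([0,T],H^2(\mathcal D)),\qquad \partial_t u\in L^4(\mathcal D\times(0,T)),\qquad \partial_{tt}u\in L^2(\mathcal D\times(0,T)).\tag{R1}$$ Then $u^{(1)}=u^{(2)}$, that is, $u^{(1)}(\cdot,t)=u^{(2)}(\cdot,t)$ for every $t\in[0,T]$. -/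

import Mathlib

open MeasureTheory Set
open scoped ContDiff ComplexConjugate

noncomputable section

namespace NLS

/-- Euclidean space `ℝ^d`. -/
abbrev E (d : ℕ) : Type := EuclideanSpace ℝ (Fin d)

/-- Complex test functions `C_c^∞(U)` on a subset `U` of a real normed space. -/
structure IsTest {F : Type*} [NormedAddCommGroup F] [NormedSpace ℝ F] (U : Set F)
    (φ : F → ℂ) : Prop where
  smooth : ContDiff ℝ ∞ φ
  compact : HasCompactSupport φ
  supp : tsupport φ ⊆ U

/-- The classical partial derivative `∂_i φ`. -/
def pderiv {d : ℕ} (i : Fin d) (φ : E d → ℂ) (x : E d) : ℂ :=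
  fderiv ℝ φ x (EuclideanSpace.single i 1)

/-- A (non-degenerate, open) convex bounded polyhedron: the nonempty interior of the convex hull of
finitely many points. -/
def IsConvexPolyhedron {d : ℕ} (D : Set (E d)) : Prop :=
  D.Nonempty ∧ ∃ s : Set (E d), s.Finite ∧ D = interior (convexHull ℝ s)

/-- `L²(D) = L²(D, ℂ)`. -/
abbrev L2 {d : ℕ} (D : Set (E d)) : Type := Lp ℂ 2 (volume.restrict D)

/-- `g` is the weak partial derivative `∂_i f` in `D`. -/
def IsWeakPDeriv {d : ℕ} (D : Set (E d)) (i : Fin d) (f g : L2 D) : Prop :=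
  ∀ φ : E d → ℂ, IsTest D φ →
    ∫ x in D, f x * pderiv i φ x = -∫ x in D, g x * φ x

lemma IsTest.memLp {d : ℕ} {D : Set (E d)} {φ : E d → ℂ} (h : IsTest D φ) :
    MemLp φ 2 (volume.restrict D) :=
  h.smooth.continuous.memLp_of_hasCompactSupport h.compact

lemma IsTest.memLp_pderiv {d : ℕ} {D : Set (E d)} {φ : E d → ℂ} (h : IsTest D φ) (i : Fin d) :
    MemLp (pderiv i φ) 2 (volume.restrict D) :=
  ((h.smooth.continuous_fderiv (by simp)).clm_apply
    continuous_const).memLp_of_hasCompactSupport (h.compact.fderiv_apply ℝ _)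

lemma IsWeakPDeriv.zero {d : ℕ} (D : Set (E d)) (i : Fin d) :
    IsWeakPDeriv D i (0 : L2 D) (0 : L2 D) := by
  intro φ _
  have h0 : ∀ ψ : E d → ℂ, ∫ x in D, (0 : L2 D) x * ψ x = 0 := fun ψ => by
    refine integral_eq_zero_of_ae ?_
    filter_upwards [Lp.coeFn_zero ℂ 2 (volume.restrict D)] with x hx
    rw [hx, Pi.zero_apply, zero_mul]
  rw [h0, h0, neg_zero]

lemma IsWeakPDeriv.add {d : ℕ} {D : Set (E d)} {i : Fin d} {f g f' g' : L2 D}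
    (h : IsWeakPDeriv D i f g) (h' : IsWeakPDeriv D i f' g') :
    IsWeakPDeriv D i (f + f') (g + g') := by
  intro φ hφ
  have e1 : ∫ x in D, (f + f') x * pderiv i φ x
      = ∫ x in D, (f x * pderiv i φ x + f' x * pderiv i φ x) := by
    refine integral_congr_ae ?_
    filter_upwards [Lp.coeFn_add f f'] with x hx
    rw [hx, Pi.add_apply, add_mul]
  have e2 : ∫ x in D, (g + g') x * φ x = ∫ x in D, (g x * φ x + g' x * φ x) := by
    refine integral_congr_ae ?_
    filter_upwards [Lp.coeFn_add g g'] with x hx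
    rw [hx, Pi.add_apply, add_mul]
  have e3 : ∫ x in D, (f x * pderiv i φ x + f' x * pderiv i φ x) = _ :=
    integral_add ((Lp.memLp f).integrable_mul (hφ.memLp_pderiv i))
      ((Lp.memLp f').integrable_mul (hφ.memLp_pderiv i))
  have e4 : ∫ x in D, (g x * φ x + g' x * φ x) = _ :=
    integral_add ((Lp.memLp g).integrable_mul hφ.memLp) ((Lp.memLp g').integrable_mul hφ.memLp)
  rw [e1, e2, e3, e4, neg_add]
  exact congrArg₂ (· + ·) (h φ hφ) (h' φ hφ)

lemma IsWeakPDeriv.smul {d : ℕ} {D : Set (E d)} {i : Fin d} {f g : L2 D} (c : ℂ)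
    (h : IsWeakPDeriv D i f g) : IsWeakPDeriv D i (c • f) (c • g) := by
  intro φ hφ
  have e1 : ∫ x in D, (c • f) x * pderiv i φ x = ∫ x in D, c * (f x * pderiv i φ x) := by
    refine integral_congr_ae ?_
    filter_upwards [Lp.coeFn_smul c f] with x hx
    rw [hx, Pi.smul_apply, smul_eq_mul, mul_assoc]
  have e2 : ∫ x in D, (c • g) x * φ x = ∫ x in D, c * (g x * φ x) := by
    refine integral_congr_ae ?_
    filter_upwards [Lp.coeFn_smul c g] with x hx
    rw [hx, Pi.smul_apply, smul_eq_mul, mul_assoc]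
  rw [e1, e2, integral_const_mul, integral_const_mul, h φ hφ, mul_neg]

/-- Pairs `(u, ∇u)` of an `L²` function and an `L²` vector field, with the norm
`(‖u‖² + ∑ i, ‖∂_i u‖²)^(1/2)` of `H¹(D)`. -/
abbrev Jet1 {d : ℕ} (D : Set (E d)) : Type :=
  WithLp 2 (L2 D × PiLp 2 (fun _ : Fin d => L2 D))

/-- Triples `((u, ∇u), ∇²u)`, with the norm of `H²(D)`. -/
abbrev Jet2 {d : ℕ} (D : Set (E d)) : Type :=
  WithLp 2 (Jet1 D × PiLp 2 (fun _ : Fin d × Fin d => L2 D))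

/-- `C_c^∞(D)` inside `H¹(D)`: the pairs `(φ, ∇φ)` for test functions `φ`. -/
def testPairs {d : ℕ} (D : Set (E d)) : Submodule ℂ (Jet1 D) where
  carrier := {p | ∃ φ : E d → ℂ, IsTest D φ ∧ p.fst =ᵐ[volume.restrict D] φ ∧
    ∀ i, p.snd i =ᵐ[volume.restrict D] pderiv i φ}
  zero_mem' := by
    refine ⟨0, ⟨contDiff_const, HasCompactSupport.zero, by simp⟩,
      Lp.coeFn_zero ℂ 2 (volume.restrict D), fun i => ?_⟩
    filter_upwards [Lp.coeFn_zero ℂ 2 (volume.restrict D)] with x hx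
    simpa [pderiv] using hx
  add_mem' := by
    rintro p q ⟨φ, hφ, h1, h2⟩ ⟨ψ, hψ, k1, k2⟩
    refine ⟨φ + ψ, ⟨hφ.smooth.add hψ.smooth, hφ.compact.add hψ.compact,
      (tsupport_add φ ψ).trans (union_subset hφ.supp hψ.supp)⟩, ?_, fun i => ?_⟩
    · exact (Lp.coeFn_add p.fst q.fst).trans (h1.add k1)
    · refine (Lp.coeFn_add (p.snd i) (q.snd i)).trans (((h2 i).add (k2 i)).trans ?_)
      refine Filter.Eventually.of_forall fun x => ?_
      have a := hφ.smooth.differentiable (by simp) x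
      have b := hψ.smooth.differentiable (by simp) x
      simp [pderiv, fderiv_add a b]
  smul_mem' := by
    rintro c p ⟨φ, hφ, h1, h2⟩
    refine ⟨c • φ, ⟨hφ.smooth.const_smul c, hφ.compact.smul_left (f := fun _ => c),
      (tsupport_smul_subset_right (fun _ => c) φ).trans hφ.supp⟩, ?_, fun i => ?_⟩
    · exact (Lp.coeFn_smul c p.fst).trans (h1.const_smul c)
    · refine (Lp.coeFn_smul c (p.snd i)).trans (((h2 i).const_smul c).trans ?_)
      refine Filter.Eventually.of_forall fun x => ?_
      have a := hφ.smooth.differentiable (by simp) x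
      simp [pderiv, fderiv_const_smul a c]

/-- The closure of `C_c^∞(D)` in the `H¹` norm. -/
def closureTestPairs {d : ℕ} (D : Set (E d)) : Submodule ℂ (Jet1 D) :=
  (testPairs D).topologicalClosure

/-- The Hilbert space `H¹₀(D)`: the closure of `C_c^∞(D)` in the `H¹` norm. An element carries the
function together with its weak gradient (which the function determines). -/
def H10 {d : ℕ} (D : Set (E d)) : Type := closureTestPairs D

instance {d : ℕ} (D : Set (E d)) : NormedAddCommGroup (H10 D) :=
  inferInstanceAs (NormedAddCommGroup (closureTestPairs D))

instance {d : ℕ} (D : Set (E d)) : InnerProductSpace ℂ (H10 D) :=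
  inferInstanceAs (InnerProductSpace ℂ (closureTestPairs D))

instance {d : ℕ} (D : Set (E d)) : CompleteSpace (H10 D) :=
  (Submodule.isClosed_topologicalClosure (testPairs D)).completeSpace_coe

/-- The inclusion of `H¹₀(D)` into the pairs `(u, ∇u)`. -/
def H10.incl {d : ℕ} (D : Set (E d)) : H10 D →L[ℂ] Jet1 D := (closureTestPairs D).subtypeL

/-- The function `u ∈ L²(D)` of an element of `H¹₀(D)`. -/
def H10.fn {d : ℕ} {D : Set (E d)} (u : H10 D) : L2 D := (H10.incl D u).fst

/-- The weak partial derivative `∂_i u ∈ L²(D)` of an element of `H¹₀(D)`. -/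
def H10.grad {d : ℕ} {D : Set (E d)} (u : H10 D) (i : Fin d) : L2 D := (H10.incl D u).snd i

/-- `H10.fn` as a continuous linear map. -/
def H10.toL2 {d : ℕ} (D : Set (E d)) : H10 D →L[ℂ] L2 D :=
  (WithLp.fstL 2 ℂ (L2 D) (PiLp 2 (fun _ : Fin d => L2 D))).comp (H10.incl D)

/-- The triples `((u, ∇u), ∇²u)` of an `L²` function and its weak partial derivatives of first and
second order, all in `L²(D)`. -/
def weakJets {d : ℕ} (D : Set (E d)) : Submodule ℂ (Jet2 D) where
  carrier := {p | (∀ i, IsWeakPDeriv D i p.fst.fst (p.fst.snd i)) ∧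
    ∀ i j, IsWeakPDeriv D j (p.fst.snd i) (p.snd (i, j))}
  zero_mem' := ⟨fun i => IsWeakPDeriv.zero D i, fun _ j => IsWeakPDeriv.zero D j⟩
  add_mem' := fun hp hq =>
    ⟨fun i => (hp.1 i).add (hq.1 i), fun i j => (hp.2 i j).add (hq.2 i j)⟩
  smul_mem' := fun c _ hp => ⟨fun i => (hp.1 i).smul c, fun i j => (hp.2 i j).smul c⟩

/-- `H²(D)`: the `L²` functions with weak partial derivatives up to order two in `L²(D)`, each
taken together with these derivatives. Its norm is the square root of the sum of the squared `L²`
norms of all derivatives up to order two. -/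
def H2 {d : ℕ} (D : Set (E d)) : Type := weakJets D

instance {d : ℕ} (D : Set (E d)) : NormedAddCommGroup (H2 D) :=
  inferInstanceAs (NormedAddCommGroup (weakJets D))

instance {d : ℕ} (D : Set (E d)) : InnerProductSpace ℂ (H2 D) :=
  inferInstanceAs (InnerProductSpace ℂ (weakJets D))

/-- The inclusion of `H²(D)` into the triples `((u, ∇u), ∇²u)`. -/
def H2.incl {d : ℕ} (D : Set (E d)) : H2 D →L[ℂ] Jet2 D := (weakJets D).subtypeL

/-- The function `u ∈ L²(D)` of an element of `H²(D)`. -/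
def H2.fn {d : ℕ} {D : Set (E d)} (u : H2 D) : L2 D := (H2.incl D u).fst.fst

/-- `H⁻¹(D)`: the bounded antilinear functionals on `H¹₀(D)`, with the dual norm. -/
def Hm1 {d : ℕ} (D : Set (E d)) : Type := H10 D →L⋆[ℂ] ℂ

instance {d : ℕ} (D : Set (E d)) : NormedAddCommGroup (Hm1 D) :=
  inferInstanceAs (NormedAddCommGroup (H10 D →L⋆[ℂ] ℂ))

instance {d : ℕ} (D : Set (E d)) : NormedSpace ℂ (Hm1 D) :=
  inferInstanceAs (NormedSpace ℂ (H10 D →L⋆[ℂ] ℂ))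

instance {d : ℕ} (D : Set (E d)) : CompleteSpace (Hm1 D) :=
  inferInstanceAs (CompleteSpace (H10 D →L⋆[ℂ] ℂ))

/-- The duality pairing `⟨f, w⟩` of `f ∈ H⁻¹(D)` with `w ∈ H¹₀(D)`, continuous and linear in `f`. -/
def Hm1.pair {d : ℕ} {D : Set (E d)} (w : H10 D) : Hm1 D →L[ℂ] ℂ :=
  ContinuousLinearMap.apply' ℂ (starRingEnd ℂ) w

/-- The embedding `H¹₀(D) ⊂ L²(D) ⊂ H⁻¹(D)`, sending `u` to `w ↦ ⟨u, w⟩ = ∫_D u * conj w`. -/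
def H10.toHm1 {d : ℕ} {D : Set (E d)} (u : H10 D) : Hm1 D :=
  (innerSLFlip ℂ (H10.toL2 D u)).comp (H10.toL2 D)

lemma H10.toHm1_pair {d : ℕ} {D : Set (E d)} (u w : H10 D) :
    Hm1.pair w u.toHm1 = ∫ x in D, u.fn x * conj (w.fn x) := by
  change inner ℂ w.fn u.fn = _
  rw [L2.inner_def]
  rfl

/-- `u' = ∂_t u` on `(0,T)` as an `H⁻¹(D)`-valued weak derivative:
`∫ φ'(t) u(t) dt = -∫ φ(t) u'(t) dt` in `H⁻¹(D)` for all `φ ∈ C_c^∞(0,T)`. -/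
def IsWeakTimeDeriv {d : ℕ} {D : Set (E d)} (T : ℝ) (u : ℝ → H10 D) (u' : ℝ → Hm1 D) : Prop :=
  ∀ φ : ℝ → ℂ, IsTest (Ioo 0 T) φ →
    ∫ t in Ioo 0 T, deriv φ t • (u t).toHm1 = -∫ t in Ioo 0 T, φ t • u' t

/-- `v = ∂_t^k u` in the sense of distributions on the space-time cylinder `(0,T) × D`. -/
def IsSpaceTimeDeriv {d : ℕ} {D : Set (E d)} (T : ℝ) (k : ℕ) (u : ℝ → H10 D)
    (v : ℝ × E d → ℂ) : Prop :=
  ∀ φ : ℝ × E d → ℂ, IsTest (Ioo 0 T ×ˢ D) φ →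
    ∫ t in Ioo 0 T, ∫ x in D, (u t).fn x * iteratedDeriv k (fun s => φ (s, x)) t
      = (-1) ^ k * ∫ p in Ioo 0 T ×ˢ D, v p * φ p

/-- The conditions on the nonlinearity: `γ : [0,∞) → [0,∞)` is smooth, `γ 0 = 0`, and
`z ↦ γ(|z|²) z` is Lipschitz on the disc of radius `K` with a constant `L(K)`, `0 ≤ L(s) ≤ C s^q`,
where `q ≥ 0`, and `q < 2` if `d = 3`. -/
structure IsAdmissibleNonlinearity (d : ℕ) (γ : ℝ → ℝ) : Prop where
  smooth : ContDiffOn ℝ ∞ γ (Ici 0)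
  nonneg : ∀ s, 0 ≤ s → 0 ≤ γ s
  zero : γ 0 = 0
  growth : ∃ (L : ℝ → ℝ) (C q : ℝ), 0 ≤ q ∧ (d = 3 → q < 2) ∧
    (∀ s, 0 ≤ s → 0 ≤ L s ∧ L s ≤ C * s ^ q) ∧
    ∀ (K : ℝ) (v w : ℂ), ‖v‖ ≤ K → ‖w‖ ≤ K →
      ‖(γ (‖v‖ ^ 2) : ℂ) * v - (γ (‖w‖ ^ 2) : ℂ) * w‖ ≤ L K * ‖v - w‖

/-- `u` is a weak solution of `i ∂_t u = -Δu + V u + γ(|u|²) u` on `[0,T]` with initial value `u0`: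
`u ∈ L^∞([0,T], H¹₀(D))`, `∂_t u ∈ L^∞([0,T], H⁻¹(D))`, the equation holds in `H⁻¹(D)` for almost
every `t`, and the representative of `u` in `C⁰([0,T], L²(D))` equals `u0` at `t = 0`. -/
structure IsSolution {d : ℕ} (D : Set (E d)) (V : E d → ℝ) (γ : ℝ → ℝ) (T : ℝ) (u0 : H10 D)
    (u : ℝ → H10 D) : Prop where
  bounded : MemLp u ⊤ (volume.restrict (Icc 0 T))
  initial : ∃ c : ℝ → L2 D, ContinuousOn c (Icc 0 T) ∧
    (∀ᵐ t ∂volume.restrict (Icc 0 T), c t = (u t).fn) ∧ c 0 = u0.fn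
  equation : ∃ u' : ℝ → Hm1 D, MemLp u' ⊤ (volume.restrict (Icc 0 T)) ∧
    IsWeakTimeDeriv T u u' ∧
    ∀ᵐ t ∂volume.restrict (Icc 0 T), ∀ w : H10 D,
      Complex.I * Hm1.pair w (u' t)
        = (∑ i, ∫ x in D, (u t).grad i x * conj (w.grad i x))
          + (∫ x in D, (V x : ℂ) * (u t).fn x * conj (w.fn x))
          + ∫ x in D, (γ (‖(u t).fn x‖ ^ 2) : ℂ) * (u t).fn x * conj (w.fn x)

/-- The regularity assumption `u ∈ C⁰([0,T], H²(D))`, `∂_t u ∈ L⁴(D × (0,T))`,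
`∂_tt u ∈ L²(D × (0,T))`. -/
structure IsRegular {d : ℕ} {D : Set (E d)} (T : ℝ) (u : ℝ → H10 D) : Prop where
  contH2 : ∃ v : ℝ → H2 D, ContinuousOn v (Icc 0 T) ∧ ∀ t ∈ Icc 0 T, (v t).fn = (u t).fn
  dt : ∃ v : ℝ × E d → ℂ, MemLp v 4 (volume.restrict (Ioo 0 T ×ˢ D)) ∧ IsSpaceTimeDeriv T 1 u v
  dtt : ∃ v : ℝ × E d → ℂ, MemLp v 2 (volume.restrict (Ioo 0 T ×ˢ D)) ∧ IsSpaceTimeDeriv T 2 u v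

end NLS

end

/-! Let `e = u₁ - u₂`. Continuity in time with values in `H²(D)`, together with the embedding of
`H²(D)` into `L^∞(D)` in dimension at most three, bounds both solutions by one constant `M` on `D ×
[0,T]`. On the disc of radius `M` the nonlinearity is Lipschitz with constant `L(M)`. Subtract the
two equations, test with `e` and take imaginary parts: the gradient and potential terms are real and
drop out, which leaves `|Re ⟨∂_t e, e⟩| ≤ L(M) ‖e‖²` in `L²` (`abs_re_pair_sub_le`). Since `e(0) =
0`, Gronwall's inequality gives `e = 0`.

Two points need work. The embedding (`exists_ae_norm_le_of_mem_weakJets`) comes from mollifying,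
writing the second order Taylor formula on segments from `y` to `x`, and averaging over `y` in a
ball. Cauchy–Schwarz and the substitution `z = (1-s)y + sx` cost a factor `(1-s)^(-d/2)`; the Taylor
weight `1-s` makes this integrable for `d ≤ 3`. Convexity of `D` keeps the segments inside.

The time derivative takes values only in `H⁻¹(D)`, so a product rule for `‖e‖²` is not immediate. It
is avoided through `‖e(t)‖² - ‖e(s)‖² = Re ⟨e(t) - e(s), e(t) + e(s)⟩ = Re ∫_s^t ⟨∂_t e(τ), e(t) +
e(s)⟩ dτ`, where the test element is fixed. Replacing it by `2e(τ)` costs at most a constant times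
`‖e(t) + e(s) - 2e(τ)‖` in `H¹`, which vanishes as `t → s` because `e` is continuous into `H¹₀(D)`.
This bounds the right derivative of `‖e‖²` (`eq_zero_of_sub_le_mul`). -/

namespace NLS

open scoped Convolution ENNReal

/-! ### Mollification: smoothness, weak derivatives, integral bounds. -/

/-- The mollification of `f` by the normalized bump function `φ`. -/
noncomputable def mollify {G : Type*} [NormedAddCommGroup G] [NormedSpace ℝ G]
    [HasContDiffBump G] [MeasureSpace G] (φ : ContDiffBump (0 : G)) (f : G → ℂ) : G → ℂ :=
  φ.normed volume ⋆[ContinuousLinearMap.lsmul ℝ ℝ, volume] f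

lemma mollify_apply {G : Type*} [NormedAddCommGroup G] [NormedSpace ℝ G]
    [HasContDiffBump G] [MeasureSpace G] (φ : ContDiffBump (0 : G)) (f : G → ℂ) (x : G) :
    mollify φ f x = ∫ t, φ.normed volume t • f (x - t) := rfl

lemma enorm_mollify_le {G : Type*} [NormedAddCommGroup G] [NormedSpace ℝ G]
    [HasContDiffBump G] [MeasureSpace G] (φ : ContDiffBump (0 : G)) (f : G → ℂ) (x : G) :
    ‖mollify φ f x‖ₑ ≤ ∫⁻ t, ‖φ.normed volume t‖ₑ * ‖f (x - t)‖ₑ := by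
  rw [mollify_apply]
  refine (enorm_integral_le_lintegral_enorm _).trans_eq ?_
  simp only [enorm_smul]

section Mollify

variable {G : Type*} [NormedAddCommGroup G] [NormedSpace ℝ G] [FiniteDimensional ℝ G]
  [MeasureSpace G] [BorelSpace G] [(volume : Measure G).IsAddHaarMeasure]

lemma contDiff_mollify (φ : ContDiffBump (0 : G)) {f : G → ℂ} (hf : LocallyIntegrable f) :
    ContDiff ℝ 1 (mollify φ f) :=
  φ.hasCompactSupport_normed.contDiff_convolution_left (n := 1) _ φ.contDiff_normed hf

lemma fderiv_mollify_eq (φ : ContDiffBump (0 : G)) {f : G → ℂ} (hf : LocallyIntegrable f)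
    (x v : G) :
    fderiv ℝ (mollify φ f) x v = ∫ y, fderiv ℝ (φ.normed volume) (x - y) v • f y := by
  have h := (φ.hasCompactSupport_normed (μ := volume)).hasFDerivAt_convolution_left (𝕜 := ℝ) (μ := volume)
    (ContinuousLinearMap.lsmul ℝ ℝ) (φ.contDiff_normed (n := 1)) hf x
  have hc : ContDiff ℝ 1 (φ.normed (volume : Measure G)) := φ.contDiff_normed (n := 1)
  rw [mollify, h.fderiv]
  have hex : ConvolutionExistsAt (fderiv ℝ (φ.normed volume)) f x
      (ContinuousLinearMap.precompL G (ContinuousLinearMap.lsmul ℝ ℝ : ℝ →L[ℝ] ℂ →L[ℝ] ℂ))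
      volume :=
    ((φ.hasCompactSupport_normed (μ := volume)).fderiv ℝ).convolutionExists_left _
      (hc.continuous_fderiv (by simp)) hf x
  rw [convolution_def, ContinuousLinearMap.integral_apply hex]
  simp only [ContinuousLinearMap.precompL_apply, ContinuousLinearMap.lsmul_apply]
  rw [← integral_sub_left_eq_self _ volume x]
  simp

/-- The derivative falls on the kernel, and the reflected kernel `y ↦ φ(x - y)` is itself an
admissible test function as soon as the ball of radius `φ.rOut` around `x` lies in `U`. The weak
derivative is thus needed only inside `U`, so functions extended by zero can be treated. -/
lemma fderiv_mollify (φ : ContDiffBump (0 : G)) {U : Set G} {f g : G → ℂ}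
    (hf : LocallyIntegrable f) {v : G}
    (h : ∀ ψ : G → ℝ, ContDiff ℝ ∞ ψ → HasCompactSupport ψ → tsupport ψ ⊆ U →
      ∫ y, fderiv ℝ ψ y v • f y = -∫ y, ψ y • g y)
    {x : G} (hx : Metric.closedBall x φ.rOut ⊆ U) :
    fderiv ℝ (mollify φ f) x v = mollify φ g x := by
  set ψ : G → ℝ := fun y => φ.normed volume (x - y) with hψ
  have hcd : ContDiff ℝ ∞ (φ.normed (volume : Measure G)) := φ.contDiff_normed (n := ⊤)
  have hsm : ContDiff ℝ ∞ ψ := hcd.comp (contDiff_const.sub contDiff_id)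
  have hts : tsupport ψ ⊆ Metric.closedBall x φ.rOut := by
    refine closure_minimal (fun y hy => ?_) Metric.isClosed_closedBall
    have h1 : x - y ∈ Function.support (φ.normed (volume : Measure G)) := hy
    rw [φ.support_normed_eq] at h1
    rw [Metric.mem_closedBall, dist_comm, dist_eq_norm]
    simpa using (mem_ball_zero_iff.1 h1).le
  have hcs : HasCompactSupport ψ :=
    (isCompact_closedBall x φ.rOut).of_isClosed_subset (isClosed_tsupport _) hts
  have key := h ψ hsm hcs (hts.trans hx)
  have hd : ∀ y, fderiv ℝ ψ y v = -fderiv ℝ (φ.normed volume) (x - y) v := fun y => by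
    have h1 : HasFDerivAt (φ.normed (volume : Measure G)) (fderiv ℝ (φ.normed volume) (x - y))
        (x - y) := (hcd.differentiable (by simp) _).hasFDerivAt
    have h2 : HasFDerivAt (fun y : G => x - y) (-ContinuousLinearMap.id ℝ G) y :=
      (hasFDerivAt_id y).const_sub x
    have h3 : HasFDerivAt ψ _ y := h1.comp y h2
    rw [h3.fderiv]
    simp
  rw [fderiv_mollify_eq φ hf, mollify_apply]
  simp only [hd, neg_smul, integral_neg, neg_inj] at key
  rw [key, ← integral_sub_left_eq_self _ volume x]
  simp [hψ]

lemma norm_mollify_le (φ : ContDiffBump (0 : G)) {f : G → ℂ} {M : ℝ} (hM : ∀ᵐ x, ‖f x‖ ≤ M)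
    (x : G) : ‖mollify φ f x‖ ≤ M := by
  rw [mollify_apply]
  have h1 : ∀ᵐ t, ‖φ.normed volume t • f (x - t)‖ ≤ φ.normed volume t * M := by
    filter_upwards [(quasiMeasurePreserving_sub_left_of_right_invariant volume x).ae hM] with t ht
    rw [norm_smul, Real.norm_of_nonneg (φ.nonneg_normed t)]
    exact mul_le_mul_of_nonneg_left ht (φ.nonneg_normed t)
  refine (norm_integral_le_of_norm_le (φ.integrable_normed.mul_const M) h1).trans_eq ?_
  rw [integral_mul_const, φ.integral_normed, one_mul]

lemma lintegral_enorm_normed (φ : ContDiffBump (0 : G)) :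
    ∫⁻ t, ‖φ.normed volume t‖ₑ = 1 := by
  have h := ofReal_integral_eq_lintegral_ofReal (φ.integrable_normed (μ := volume))
    (Filter.Eventually.of_forall φ.nonneg_normed)
  rw [φ.integral_normed, ENNReal.ofReal_one] at h
  rw [h]
  exact lintegral_congr fun t => Real.enorm_of_nonneg (φ.nonneg_normed t)

/-- Cauchy–Schwarz on `B` combined with the substitution `z = a • y + c`. -/
lemma setLIntegral_comp_affine_le {f : G → ℂ} (hf : Measurable f) (B : Set G) {a : ℝ} (ha : 0 < a)
    (c : G) :
    ∫⁻ y in B, ‖f (a • y + c)‖ₑ ≤ volume B ^ (1 / 2 : ℝ) *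
      (ENNReal.ofReal ((a ^ Module.finrank ℝ G)⁻¹) ^ (1 / 2 : ℝ) * eLpNorm f 2 volume) := by
  have hm : Measurable fun y => f (a • y + c) := by fun_prop
  have h1 := eLpNorm_le_eLpNorm_mul_rpow_measure_univ (μ := volume.restrict B) (p := 1) (q := 2)
    (by norm_num) hm.aestronglyMeasurable
  rw [eLpNorm_one_eq_lintegral_enorm] at h1
  refine h1.trans ?_
  rw [mul_comm, Measure.restrict_apply_univ]
  norm_num only [ENNReal.toReal_one, ENNReal.toReal_ofNat]
  gcongr
  refine (eLpNorm_mono_measure _ Measure.restrict_le_self).trans ?_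
  rw [eLpNorm_eq_lintegral_rpow_enorm_toReal (by norm_num) (by norm_num),
    eLpNorm_eq_lintegral_rpow_enorm_toReal (by norm_num) (by norm_num),
    ENNReal.toReal_ofNat, ← ENNReal.mul_rpow_of_nonneg _ _ (by norm_num)]
  refine le_of_eq ?_
  congr 1
  have hk : Measurable fun z => ‖f (z + c)‖ₑ ^ (2 : ℝ) := by fun_prop
  have h2 : ∫⁻ y, ‖f (a • y + c)‖ₑ ^ (2 : ℝ)
      = ∫⁻ z, ‖f (z + c)‖ₑ ^ (2 : ℝ) ∂(Measure.map (fun y => a • y) volume) := by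
    rw [lintegral_map hk (measurable_const_smul a)]
  rw [h2, Measure.map_addHaar_smul _ ha.ne', lintegral_smul_measure, smul_eq_mul,
    abs_of_pos (by positivity), lintegral_add_right_eq_self (fun z => ‖f z‖ₑ ^ (2 : ℝ)) c]

/-- A mollification is an average of translates of `f`, and the bound of
`setLIntegral_comp_affine_le` does not depend on the shift `c`; Tonelli transfers it with the same
constant. -/
lemma setLIntegral_mollify_comp_affine_le (φ : ContDiffBump (0 : G)) {f : G → ℂ}
    (hf : Measurable f) (B : Set G) {a : ℝ} (ha : 0 < a) (c : G) :
    ∫⁻ y in B, ‖mollify φ f (a • y + c)‖ₑ ≤ volume B ^ (1 / 2 : ℝ) *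
      (ENNReal.ofReal ((a ^ Module.finrank ℝ G)⁻¹) ^ (1 / 2 : ℝ) * eLpNorm f 2 volume) := by
  have hφ : Measurable (φ.normed (volume : Measure G)) := φ.continuous_normed.measurable
  calc ∫⁻ y in B, ‖mollify φ f (a • y + c)‖ₑ
      ≤ ∫⁻ y in B, ∫⁻ t, ‖φ.normed volume t‖ₑ * ‖f (a • y + c - t)‖ₑ :=
        lintegral_mono fun y => enorm_mollify_le φ f _
    _ = ∫⁻ t, ∫⁻ y in B, ‖φ.normed volume t‖ₑ * ‖f (a • y + c - t)‖ₑ := by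
        refine lintegral_lintegral_swap ?_
        have : Measurable fun p : G × G => ‖φ.normed volume p.2‖ₑ * ‖f (a • p.1 + c - p.2)‖ₑ := by
          fun_prop
        exact this.aemeasurable
    _ = ∫⁻ t, ‖φ.normed volume t‖ₑ * ∫⁻ y in B, ‖f (a • y + (c - t))‖ₑ := by
        refine lintegral_congr fun t => ?_
        rw [lintegral_const_mul _ (by fun_prop)]
        simp only [add_sub_assoc]
    _ ≤ ∫⁻ t, ‖φ.normed volume t‖ₑ * (volume B ^ (1 / 2 : ℝ) *
          (ENNReal.ofReal ((a ^ Module.finrank ℝ G)⁻¹) ^ (1 / 2 : ℝ) * eLpNorm f 2 volume)) :=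
        lintegral_mono fun t => by
          gcongr
          exact setLIntegral_comp_affine_le hf B ha _
    _ = _ := by
        rw [lintegral_mul_const _ (by fun_prop), lintegral_enorm_normed, one_mul]

end Mollify

/-- A sequence of bump functions on `G` whose supports shrink to the origin. -/
noncomputable def bumpSeq {G : Type*} [NormedAddCommGroup G] (n : ℕ) : ContDiffBump (0 : G) :=
  ⟨1 / ((n : ℝ) + 1) / 2, 1 / ((n : ℝ) + 1), by positivity, half_lt_self (by positivity)⟩

lemma tendsto_bumpSeq_rOut (G : Type*) [NormedAddCommGroup G] :
    Filter.Tendsto (fun n => (bumpSeq n : ContDiffBump (0 : G)).rOut) Filter.atTop (nhds 0) :=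
  tendsto_one_div_add_atTop_nhds_zero_nat

lemma ae_tendsto_mollify_bumpSeq {G : Type*} [NormedAddCommGroup G] [NormedSpace ℝ G]
    [FiniteDimensional ℝ G] [MeasureSpace G] [BorelSpace G] [(volume : Measure G).IsAddHaarMeasure]
    {f : G → ℂ} (hf : LocallyIntegrable f) :
    ∀ᵐ x, Filter.Tendsto (fun n => mollify (bumpSeq n) f x) Filter.atTop (nhds (f x)) :=
  -- `K` bounds the ratio of outer to inner radius, which `bumpSeq` keeps equal to 2.
  ContDiffBump.ae_convolution_tendsto_right_of_locallyIntegrable (K := 2) (tendsto_bumpSeq_rOut G)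
    (Filter.Eventually.of_forall fun n => by simp only [bumpSeq]; linarith) hf

/-! ### Taylor's formula for mollified `H²` functions. -/

section Sobolev

variable {d : ℕ} {D : Set (E d)}

lemma measurable_indicator_coe (hD : MeasurableSet D) (f : L2 D) :
    Measurable (D.indicator (f : E d → ℂ)) :=
  (Lp.stronglyMeasurable f).measurable.indicator hD

lemma eLpNorm_indicator_coe (hD : MeasurableSet D) (f : L2 D) :
    eLpNorm (D.indicator (f : E d → ℂ)) 2 volume = ‖f‖ₑ := by
  rw [eLpNorm_indicator_eq_eLpNorm_restrict hD, Lp.enorm_def]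

lemma locallyIntegrable_indicator_coe (hD : MeasurableSet D) (f : L2 D) :
    LocallyIntegrable (D.indicator (f : E d → ℂ)) := by
  have : MemLp (D.indicator (f : E d → ℂ)) 2 volume :=
    (memLp_indicator_iff_restrict hD).2 (Lp.memLp f)
  exact this.locallyIntegrable (by norm_num)

/-- The complexification of a real test function. -/
lemma isTest_ofReal {F : Type*} [NormedAddCommGroup F] [NormedSpace ℝ F] {U : Set F}
    {ψ : F → ℝ} (h1 : ContDiff ℝ ∞ ψ) (h2 : HasCompactSupport ψ) (h3 : tsupport ψ ⊆ U) :
    IsTest U (fun x => (ψ x : ℂ)) where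
  smooth := Complex.ofRealCLM.contDiff.comp h1
  compact := h2.comp_left (g := fun r : ℝ => (r : ℂ)) Complex.ofReal_zero
  supp := (closure_mono (Function.support_comp_subset (g := fun r : ℝ => (r : ℂ))
    Complex.ofReal_zero ψ)).trans h3

lemma pderiv_ofReal {ψ : E d → ℝ} (h1 : ContDiff ℝ ∞ ψ) (i : Fin d) (x : E d) :
    pderiv i (fun x => (ψ x : ℂ)) x = (fderiv ℝ ψ x (EuclideanSpace.single i 1) : ℝ) := by
  have h := Complex.ofRealCLM.hasFDerivAt.comp x (h1.differentiable (by simp) x).hasFDerivAt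
  have h' : HasFDerivAt (fun x => (ψ x : ℂ)) _ x := h
  rw [pderiv, h'.fderiv]
  rfl

lemma IsWeakPDeriv.integral_fderiv_smul (hD : MeasurableSet D) {i : Fin d} {f g : L2 D}
    (h : IsWeakPDeriv D i f g) (ψ : E d → ℝ) (h1 : ContDiff ℝ ∞ ψ) (h2 : HasCompactSupport ψ)
    (h3 : tsupport ψ ⊆ D) :
    ∫ y, fderiv ℝ ψ y (EuclideanSpace.single i 1) • D.indicator (f : E d → ℂ) y
      = -∫ y, ψ y • D.indicator (g : E d → ℂ) y := by
  have key := h _ (isTest_ofReal h1 h2 h3)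
  have e : ∀ (c : E d → ℝ) (k : L2 D),
      ∫ y, c y • D.indicator (k : E d → ℂ) y = ∫ y in D, k y * (c y : ℂ) := fun c k => by
    rw [← integral_indicator hD]
    refine integral_congr_ae (Filter.Eventually.of_forall fun y => ?_)
    by_cases hy : y ∈ D <;> simp [hy, mul_comm]
  rw [e, e, ← key]
  simp only [pderiv_ofReal h1]

lemma fderiv_mollify_of_isWeakPDeriv (hD : MeasurableSet D) {f : L2 D} {g : Fin d → L2 D}
    (h : ∀ i, IsWeakPDeriv D i f (g i)) (φ : ContDiffBump (0 : E d)) {x : E d}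
    (hx : Metric.closedBall x φ.rOut ⊆ D) (v : E d) :
    fderiv ℝ (mollify φ (D.indicator (f : E d → ℂ))) x v
      = ∑ i, v i • mollify φ (D.indicator (g i : E d → ℂ)) x := by
  have hv : v = ∑ i, v i • EuclideanSpace.single i (1 : ℝ) := by
    simpa using ((EuclideanSpace.basisFun (Fin d) ℝ).sum_repr v).symm
  conv_lhs => rw [hv]
  rw [map_sum]
  refine Finset.sum_congr rfl fun i _ => ?_
  rw [map_smul, fderiv_mollify φ (locallyIntegrable_indicator_coe hD f)
    ((h i).integral_fderiv_smul hD) hx]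

/-- Second order Taylor formula along a segment, with integral remainder. -/
lemma taylor_segment {F : E d → ℂ} {A : Fin d → E d → ℂ} {H : Fin d → Fin d → E d → ℂ}
    (hF : Differentiable ℝ F) (hA : ∀ i, Differentiable ℝ (A i)) (hH : ∀ i j, Continuous (H i j))
    {x y : E d} {S : Set (E d)}
    (hS : ∀ s ∈ Icc (0 : ℝ) 1, (1 - s) • y + s • x ∈ S)
    (hFA : ∀ z ∈ S, ∀ v, fderiv ℝ F z v = ∑ i, v i • A i z)
    (hAH : ∀ i, ∀ z ∈ S, ∀ v, fderiv ℝ (A i) z v = ∑ j, v j • H i j z) :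
    F x = F y + ∑ i, (x - y) i • A i y
      + ∫ s in (0 : ℝ)..1, (1 - s) • ∑ i, (x - y) i • ∑ j, (x - y) j •
          H i j ((1 - s) • y + s • x) := by
  set z : ℝ → E d := fun s => (1 - s) • y + s • x with hz
  have hzd : ∀ s, HasDerivAt z (x - y) s := fun s => by
    have h : HasDerivAt z (-(1 : ℝ) • y + (1 : ℝ) • x) s :=
      (((hasDerivAt_id s).const_sub 1).smul_const y).add ((hasDerivAt_id s).smul_const x)
    convert h using 1
    module
  have hFd : ∀ s ∈ Icc (0 : ℝ) 1, HasDerivAt (fun s => F (z s)) (∑ i, (x - y) i • A i (z s)) s :=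
    fun s hs => by
      have := (hF (z s)).hasFDerivAt.comp_hasDerivAt s (hzd s)
      rwa [hFA _ (hS s hs)] at this
  have hAd : ∀ i, ∀ s ∈ Icc (0 : ℝ) 1,
      HasDerivAt (fun s => A i (z s)) (∑ j, (x - y) j • H i j (z s)) s := fun i s hs => by
    have := (hA i (z s)).hasFDerivAt.comp_hasDerivAt s (hzd s)
    rwa [hAH i _ (hS s hs)] at this
  have hint : IntervalIntegrable
      (fun s : ℝ => (1 - s) • ∑ i, (x - y) i • ∑ j, (x - y) j • H i j (z s)) volume 0 1 := by
    refine Continuous.intervalIntegrable ?_ _ _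
    fun_prop
  -- In the derivative of this primitive the first order terms cancel: the factor `1 - s`
  -- contributes the negative of the derivative of `F ∘ z`.
  have hP : ∀ s ∈ uIcc (0 : ℝ) 1,
      HasDerivAt (fun s => F (z s) + (1 - s) • ∑ i, (x - y) i • A i (z s))
        ((1 - s) • ∑ i, (x - y) i • ∑ j, (x - y) j • H i j (z s)) s := fun s hs => by
    rw [uIcc_of_le zero_le_one] at hs
    have h2 : HasDerivAt (fun s => ∑ i, (x - y) i • A i (z s))
        (∑ i, (x - y) i • ∑ j, (x - y) j • H i j (z s)) s :=
      HasDerivAt.fun_sum fun i _ => (hAd i s hs).fun_const_smul _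
    refine ((hFd s hs).fun_add (((hasDerivAt_id' s).const_sub 1).fun_smul h2)).congr_deriv ?_
    module
  rw [intervalIntegral.integral_eq_sub_of_hasDerivAt hP hint]
  simp [hz]

lemma mollify_taylor (hD : MeasurableSet D) (hconv : Convex ℝ D) {p : Jet2 D}
    (hp : p ∈ weakJets D) (φ : ContDiffBump (0 : E d)) {x y : E d}
    (hx : Metric.closedBall x φ.rOut ⊆ D) (hy : Metric.closedBall y φ.rOut ⊆ D) :
    mollify φ (D.indicator (p.fst.fst : E d → ℂ)) x
      = mollify φ (D.indicator (p.fst.fst : E d → ℂ)) y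
        + ∑ i, (x - y) i • mollify φ (D.indicator (p.fst.snd i : E d → ℂ)) y
        + ∫ s in (0 : ℝ)..1, (1 - s) • ∑ i, (x - y) i • ∑ j, (x - y) j •
            mollify φ (D.indicator (p.snd (i, j) : E d → ℂ)) ((1 - s) • y + s • x) := by
  have hsm : ∀ f : L2 D, ContDiff ℝ 1 (mollify φ (D.indicator (f : E d → ℂ))) := fun f =>
    contDiff_mollify φ (locallyIntegrable_indicator_coe hD f)
  refine taylor_segment (A := fun i => mollify φ (D.indicator (p.fst.snd i : E d → ℂ)))
    (H := fun i j => mollify φ (D.indicator (p.snd (i, j) : E d → ℂ)))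
    (S := {z | Metric.closedBall z φ.rOut ⊆ D})
    ((hsm _).differentiable (by simp)) (fun i => (hsm _).differentiable (by simp))
    (fun i j => (hsm _).continuous) (fun s hs w hw => ?_)
    (fun z hz v => fderiv_mollify_of_isWeakPDeriv hD hp.1 φ hz v)
    (fun i z hz v => fderiv_mollify_of_isWeakPDeriv hD (hp.2 i) φ hz v)
  set z := (1 - s) • y + s • x with hz
  have hw' : ‖w - z‖ ≤ φ.rOut := by rwa [← dist_eq_norm]
  -- Translating the segment by `w - z` keeps its endpoints in `D`, and by convexity also the
  -- translate `w` of `z`.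
  have h1 : y + (w - z) ∈ D := hy (by simpa [dist_eq_norm] using hw')
  have h2 : x + (w - z) ∈ D := hx (by simpa [dist_eq_norm] using hw')
  have := hconv h1 h2 (by linarith [hs.2] : (0 : ℝ) ≤ 1 - s) hs.1 (by ring)
  convert this using 1
  rw [hz]
  module

lemma enorm_mollify_le_taylor (hD : MeasurableSet D) (hconv : Convex ℝ D) {R : ℝ}
    (hR : ∀ x ∈ D, ∀ y ∈ D, ‖x - y‖ ≤ R) {p : Jet2 D}
    (hp : p ∈ weakJets D) (φ : ContDiffBump (0 : E d)) {x y : E d}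
    (hx : Metric.closedBall x φ.rOut ⊆ D) (hy : Metric.closedBall y φ.rOut ⊆ D) :
    ‖mollify φ (D.indicator (p.fst.fst : E d → ℂ)) x‖ₑ
      ≤ ‖mollify φ (D.indicator (p.fst.fst : E d → ℂ)) y‖ₑ
        + ∑ i, ENNReal.ofReal R * ‖mollify φ (D.indicator (p.fst.snd i : E d → ℂ)) y‖ₑ
        + ∫⁻ s in Ioo (0 : ℝ) 1, ENNReal.ofReal (1 - s) * ∑ i, ∑ j, ENNReal.ofReal R ^ 2 *
            ‖mollify φ (D.indicator (p.snd (i, j) : E d → ℂ)) ((1 - s) • y + s • x)‖ₑ := by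
  have hc : ∀ i, ‖(x - y) i‖ₑ ≤ ENNReal.ofReal R := fun i => by
    rw [← ofReal_norm]
    refine ENNReal.ofReal_le_ofReal ((PiLp.norm_apply_le (x - y) i).trans ?_)
    exact hR x (hx (Metric.mem_closedBall_self φ.rOut_pos.le)) y
      (hy (Metric.mem_closedBall_self φ.rOut_pos.le))
  rw [mollify_taylor hD hconv hp φ hx hy]
  refine (enorm_add_le _ _).trans (add_le_add ((enorm_add_le _ _).trans (add_le_add le_rfl ?_)) ?_)
  · refine (enorm_sum_le _ _).trans (Finset.sum_le_sum fun i _ => ?_)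
    rw [enorm_smul]
    gcongr
    exact hc i
  · rw [intervalIntegral.integral_of_le zero_le_one, ← restrict_Ioo_eq_restrict_Ioc]
    refine (enorm_integral_le_lintegral_enorm _).trans
      (setLIntegral_mono' measurableSet_Ioo fun s hs => ?_)
    rw [enorm_smul, Real.enorm_of_nonneg (by linarith [hs.2])]
    gcongr
    refine (enorm_sum_le _ _).trans (Finset.sum_le_sum fun i _ => ?_)
    rw [enorm_smul]
    refine (mul_le_mul' (hc i) (enorm_sum_le _ _)).trans ?_
    rw [Finset.mul_sum]
    refine Finset.sum_le_sum fun j _ => ?_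
    rw [enorm_smul, pow_two, mul_assoc]
    gcongr
    exact hc j

end Sobolev

/-! ### The embedding of `H²` into `L^∞`. -/

section Sobolev

variable {d : ℕ} {D : Set (E d)}

/-- The restriction on the dimension enters here: the integrand is `(1-s)^(1-d/2)`, and in the worst
case `d = 3` it is the integrable `(1-s)^(-1/2)`. -/
lemma taylor_weight_lintegral_lt_top (hd : d ≤ 3) :
    ∫⁻ s in Ioo (0 : ℝ) 1, ENNReal.ofReal (1 - s) *
      ENNReal.ofReal (((1 - s) ^ d)⁻¹) ^ (1 / 2 : ℝ) < ⊤ := by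
  have h1 : IntervalIntegrable (fun s : ℝ => (1 - s) ^ (-(1 / 2) : ℝ)) volume 0 1 := by
    have := (intervalIntegral.intervalIntegrable_rpow' (a := 0) (b := 1)
      (r := -(1 / 2)) (by norm_num)).comp_sub_left 1
    simpa using this.symm
  have h2 : IntegrableOn (fun s : ℝ => (1 - s) ^ (-(1 / 2) : ℝ)) (Ioo 0 1) volume :=
    ((intervalIntegrable_iff_integrableOn_Ioc_of_le zero_le_one).1 h1).mono_set Ioo_subset_Ioc_self
  refine lt_of_le_of_lt (setLIntegral_mono' measurableSet_Ioo fun s hs => ?_) h2.lintegral_lt_top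
  have ha : 0 < 1 - s := by linarith [hs.2]
  have ha1 : 1 - s ≤ 1 := by linarith [hs.1]
  rw [ENNReal.ofReal_rpow_of_pos (by positivity), ← ENNReal.ofReal_mul ha.le]
  refine ENNReal.ofReal_le_ofReal ?_
  calc (1 - s) * ((1 - s) ^ d)⁻¹ ^ (1 / 2 : ℝ)
      ≤ (1 - s) * ((1 - s) ^ 3)⁻¹ ^ (1 / 2 : ℝ) := by
        gcongr (1 - s) * ?_⁻¹ ^ (1 / 2 : ℝ)
        exact pow_le_pow_of_le_one ha.le ha1 hd
    _ = (1 - s) ^ (-(1 / 2) : ℝ) := by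
        rw [Real.inv_rpow (by positivity), ← Real.rpow_natCast, ← Real.rpow_mul ha.le,
          ← Real.rpow_neg ha.le]
        nth_rewrite 1 [← Real.rpow_one (1 - s)]
        rw [← Real.rpow_add ha]
        norm_num

lemma Jet2.enorm_fn_le (p : Jet2 D) : ‖p.fst.fst‖ₑ ≤ ‖p‖ₑ :=
  enorm_le_iff_norm_le.2 ((WithLp.norm_fst_le _ p.fst).trans (WithLp.norm_fst_le _ p))

lemma Jet2.enorm_grad_le (p : Jet2 D) (i : Fin d) : ‖p.fst.snd i‖ₑ ≤ ‖p‖ₑ :=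
  enorm_le_iff_norm_le.2 ((PiLp.norm_apply_le _ i).trans
    ((WithLp.norm_snd_le _ p.fst).trans (WithLp.norm_fst_le _ p)))

lemma Jet2.enorm_hess_le (p : Jet2 D) (i : Fin d × Fin d) : ‖p.snd i‖ₑ ≤ ‖p‖ₑ :=
  enorm_le_iff_norm_le.2 ((PiLp.norm_apply_le _ i).trans (WithLp.norm_snd_le _ p))

/-- Averaging the Taylor formula over the base point `y ∈ B`. -/
lemma volume_mul_enorm_mollify_le (hD : MeasurableSet D) (hconv : Convex ℝ D)
    {R : ℝ} (hR : ∀ x ∈ D, ∀ y ∈ D, ‖x - y‖ ≤ R) {B : Set (E d)} (hB : MeasurableSet B)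
    (φ : ContDiffBump (0 : E d)) (hBD : ∀ y ∈ B, Metric.closedBall y φ.rOut ⊆ D) {p : Jet2 D}
    (hp : p ∈ weakJets D) {x : E d} (hx : Metric.closedBall x φ.rOut ⊆ D) :
    volume B * ‖mollify φ (D.indicator (p.fst.fst : E d → ℂ)) x‖ₑ
      ≤ (volume B ^ (1 / 2 : ℝ) * (1 + d * ENNReal.ofReal R + d * d * ENNReal.ofReal R ^ 2 *
        ∫⁻ s in Ioo (0 : ℝ) 1, ENNReal.ofReal (1 - s) *
          ENNReal.ofReal (((1 - s) ^ d)⁻¹) ^ (1 / 2 : ℝ))) * ‖p‖ₑ := by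
  have hmc : ∀ f : L2 D, Continuous (mollify φ (D.indicator (f : E d → ℂ))) := fun f =>
    (contDiff_mollify φ (locallyIntegrable_indicator_coe hD f)).continuous
  have hme : ∀ f : L2 D, Measurable (mollify φ (D.indicator (f : E d → ℂ))) := fun f =>
    (hmc f).measurable
  have hfr : Module.finrank ℝ (E d) = d := by simp
  have hest : ∀ f : L2 D, ‖f‖ₑ ≤ ‖p‖ₑ → ∀ (a : ℝ) (c : E d), 0 < a →
      ∫⁻ y in B, ‖mollify φ (D.indicator (f : E d → ℂ)) (a • y + c)‖ₑ ≤
        volume B ^ (1 / 2 : ℝ) * (ENNReal.ofReal ((a ^ d)⁻¹) ^ (1 / 2 : ℝ) * ‖p‖ₑ) := by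
    intro f hf a c ha
    refine (setLIntegral_mollify_comp_affine_le φ (measurable_indicator_coe hD f) B ha c).trans ?_
    rw [eLpNorm_indicator_coe hD, hfr]
    gcongr
  have hest1 : ∀ f : L2 D, ‖f‖ₑ ≤ ‖p‖ₑ →
      ∫⁻ y in B, ‖mollify φ (D.indicator (f : E d → ℂ)) y‖ₑ ≤ volume B ^ (1 / 2 : ℝ) * ‖p‖ₑ := by
    intro f hf
    simpa using hest f hf 1 0 one_pos
  set V := volume B ^ (1 / 2 : ℝ) with hV
  set N := ‖p‖ₑ with hN
  set Q := ENNReal.ofReal R with hQ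
  have h1 : ∫⁻ y in B, ∑ i, Q * ‖mollify φ (D.indicator (p.fst.snd i : E d → ℂ)) y‖ₑ
      ≤ d * Q * (V * N) := by
    rw [lintegral_finsetSum _ fun i _ => (hme _).enorm.const_mul _]
    refine (Finset.sum_le_card_nsmul _ _ (Q * (V * N)) fun i _ => ?_).trans_eq (by
      simp [mul_assoc])
    rw [lintegral_const_mul _ (hme _).enorm]
    gcongr
    exact hest1 _ (Jet2.enorm_grad_le p i)
  have h2 : ∫⁻ y in B, ∫⁻ s in Ioo (0 : ℝ) 1, ENNReal.ofReal (1 - s) * ∑ i, ∑ j, Q ^ 2 *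
        ‖mollify φ (D.indicator (p.snd (i, j) : E d → ℂ)) ((1 - s) • y + s • x)‖ₑ
      ≤ d * d * Q ^ 2 * (∫⁻ s in Ioo (0 : ℝ) 1, ENNReal.ofReal (1 - s) *
          ENNReal.ofReal (((1 - s) ^ d)⁻¹) ^ (1 / 2 : ℝ)) * (V * N) := by
    have hm2 : ∀ i j, Measurable fun q : E d × ℝ =>
        ‖mollify φ (D.indicator (p.snd (i, j) : E d → ℂ)) ((1 - q.2) • q.1 + q.2 • x)‖ₑ :=
      fun i j => ((hmc _).comp (by fun_prop)).measurable.enorm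
    have hm3 : ∀ i j, ∀ s : ℝ, Measurable fun y : E d =>
        ‖mollify φ (D.indicator (p.snd (i, j) : E d → ℂ)) ((1 - s) • y + s • x)‖ₑ :=
      fun i j s => ((hmc _).comp (by fun_prop)).measurable.enorm
    -- With `s` fixed and `y` integrated first, `y ↦ (1-s)y + sx` is affine with dilation factor `1
    -- - s`, so `hest` applies for each `s`.
    rw [lintegral_lintegral_swap]
    · rw [mul_right_comm, ← lintegral_const_mul _ (by fun_prop)]
      refine setLIntegral_mono' measurableSet_Ioo fun s hs => ?_
      rw [lintegral_const_mul _ (Finset.measurable_fun_sum _ fun i _ =>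
          Finset.measurable_fun_sum _ fun j _ => (hm3 i j s).const_mul _),
        lintegral_finsetSum _ fun i _ => Finset.measurable_fun_sum _ fun j _ => (hm3 i j s).const_mul _]
      have : ∀ i j : Fin d, ∫⁻ y in B, Q ^ 2 *
          ‖mollify φ (D.indicator (p.snd (i, j) : E d → ℂ)) ((1 - s) • y + s • x)‖ₑ
          ≤ Q ^ 2 * (V * (ENNReal.ofReal (((1 - s) ^ d)⁻¹) ^ (1 / 2 : ℝ) * N)) := fun i j => by
        rw [lintegral_const_mul _ (hm3 i j s)]
        gcongr
        exact hest _ (Jet2.enorm_hess_le p (i, j)) _ _ (by linarith [hs.2])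
      calc _ ≤ ENNReal.ofReal (1 - s) * ∑ i : Fin d, ∑ j : Fin d,
            Q ^ 2 * (V * (ENNReal.ofReal (((1 - s) ^ d)⁻¹) ^ (1 / 2 : ℝ) * N)) := by
            gcongr with i _
            rw [lintegral_finsetSum _ fun j _ => (hm3 i j s).const_mul _]
            exact Finset.sum_le_sum fun j _ => this i j
        _ = _ := by
            simp only [Finset.sum_const, Finset.card_univ, Fintype.card_fin, nsmul_eq_mul]
            ring
    · refine Measurable.aemeasurable ?_
      refine Measurable.mul (by fun_prop) (Finset.measurable_fun_sum _ fun i _ =>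
        Finset.measurable_fun_sum _ fun j _ => (hm2 i j).const_mul _)
  calc volume B * ‖mollify φ (D.indicator (p.fst.fst : E d → ℂ)) x‖ₑ
      = ∫⁻ _ in B, ‖mollify φ (D.indicator (p.fst.fst : E d → ℂ)) x‖ₑ := by
        rw [setLIntegral_const, mul_comm]
    _ ≤ _ := setLIntegral_mono' hB fun y hy =>
        enorm_mollify_le_taylor hD hconv hR hp φ hx (hBD y hy)
    _ ≤ V * N + d * Q * (V * N) + d * d * Q ^ 2 * (∫⁻ s in Ioo (0 : ℝ) 1, ENNReal.ofReal (1 - s) *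
          ENNReal.ofReal (((1 - s) ^ d)⁻¹) ^ (1 / 2 : ℝ)) * (V * N) := by
        have hm1 : Measurable fun y => ‖mollify φ (D.indicator (p.fst.fst : E d → ℂ)) y‖ₑ +
            ∑ i, Q * ‖mollify φ (D.indicator (p.fst.snd i : E d → ℂ)) y‖ₑ :=
          (hme _).enorm.add (Finset.measurable_fun_sum _ fun i _ => (hme _).enorm.const_mul _)
        rw [lintegral_add_left hm1, lintegral_add_left (hme _).enorm]
        exact add_le_add (add_le_add (hest1 _ (Jet2.enorm_fn_le p)) h1) h2
    _ = _ := by ring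

/-- Sobolev embedding `H²(D) ⊂ L^∞(D)` for bounded convex open sets in dimension at most three. -/
lemma exists_ae_norm_le_of_mem_weakJets (hd : d ≤ 3) (hopen : IsOpen D) (hconv : Convex ℝ D)
    (hbdd : Bornology.IsBounded D) (hne : D.Nonempty) :
    ∃ C : ℝ, 0 ≤ C ∧ ∀ p ∈ weakJets D, ∀ᵐ x ∂volume.restrict D,
      ‖(p.fst.fst : E d → ℂ) x‖ ≤ C * ‖p‖ := by
  have hD := hopen.measurableSet
  obtain ⟨R, hR⟩ := Metric.isBounded_iff.1 hbdd
  simp only [dist_eq_norm] at hR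
  obtain ⟨x₀, hx₀⟩ := hne
  obtain ⟨r, hr, hrD⟩ := Metric.isOpen_iff.1 hopen x₀ hx₀
  -- Half the radius leaves room for mollification: balls of radius below `r / 2` around points of
  -- `B` stay in `D`.
  set B := Metric.ball x₀ (r / 2)
  have hB0 : volume B ≠ 0 := (Metric.measure_ball_pos _ _ (by positivity)).ne'
  have hBt : volume B ≠ ⊤ := measure_ball_lt_top.ne
  set K : ℝ≥0∞ := volume B ^ (1 / 2 : ℝ) * (1 + d * ENNReal.ofReal R +
    d * d * ENNReal.ofReal R ^ 2 * ∫⁻ s in Ioo (0 : ℝ) 1, ENNReal.ofReal (1 - s) *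
      ENNReal.ofReal (((1 - s) ^ d)⁻¹) ^ (1 / 2 : ℝ)) with hK
  have hKt : K ≠ ⊤ := by
    have := (taylor_weight_lintegral_lt_top hd).ne
    refine ENNReal.mul_ne_top (ENNReal.rpow_ne_top_of_nonneg (by norm_num) hBt) ?_
    refine ENNReal.add_ne_top.2 ⟨ENNReal.add_ne_top.2 ⟨ENNReal.one_ne_top, ?_⟩, ?_⟩
    · exact ENNReal.mul_ne_top (ENNReal.natCast_ne_top d) ENNReal.ofReal_ne_top
    · exact ENNReal.mul_ne_top (ENNReal.mul_ne_top (ENNReal.mul_ne_top (ENNReal.natCast_ne_top d)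
        (ENNReal.natCast_ne_top d)) (ENNReal.pow_ne_top ENNReal.ofReal_ne_top)) this
  have hC : (volume B)⁻¹ * K ≠ ⊤ := ENNReal.mul_ne_top (ENNReal.inv_ne_top.2 hB0) hKt
  refine ⟨((volume B)⁻¹ * K).toReal, ENNReal.toReal_nonneg, fun p hp => ?_⟩
  -- The bound for the mollified function has a constant independent of `n`, so it survives the
  -- almost everywhere limit.
  have hlim := ae_tendsto_mollify_bumpSeq (locallyIntegrable_indicator_coe hD p.fst.fst)
  filter_upwards [ae_restrict_of_ae hlim, ae_restrict_mem hD] with x hx hxD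
  rw [indicator_of_mem hxD] at hx
  obtain ⟨δ, hδ, hδD⟩ := Metric.isOpen_iff.1 hopen x hxD
  refine le_of_tendsto hx.norm ?_
  filter_upwards [(tendsto_bumpSeq_rOut (E d)).eventually_lt_const hδ,
    (tendsto_bumpSeq_rOut (E d)).eventually_lt_const (half_pos hr)] with n hn1 hn2
  have hb := volume_mul_enorm_mollify_le hD hconv (fun x hx y hy => hR hx hy)
    (B := B) Metric.isOpen_ball.measurableSet (bumpSeq n) (fun y hy => fun w hw => hrD ?_) hp (x := x)
    ((Metric.closedBall_subset_ball hn1).trans hδD)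
  · have h2 : ‖mollify (bumpSeq n) (D.indicator (p.fst.fst : E d → ℂ)) x‖ₑ
        ≤ (volume B)⁻¹ * K * ‖p‖ₑ := by
      rw [mul_assoc]
      rwa [← hK, mul_comm (volume B), ← ENNReal.le_div_iff_mul_le (Or.inl hB0) (Or.inl hBt),
        ENNReal.div_eq_inv_mul] at hb
    have h3 := ENNReal.toReal_mono (ENNReal.mul_ne_top hC enorm_ne_top) h2
    rwa [ENNReal.toReal_mul, toReal_enorm, toReal_enorm] at h3
  · have h1 : dist w y < r / 2 := (Metric.mem_closedBall.1 hw).trans_lt hn2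
    have h2 : dist y x₀ < r / 2 := hy
    exact Metric.mem_ball.2 (by linarith [dist_triangle w y x₀])

end Sobolev

/-! ### Scalar weak derivatives in time. -/

section WeakDerivative

variable {T M : ℝ} {a b : ℝ → ℂ}

/-- The mollified functions satisfy the fundamental theorem of calculus. On the left the limit is
pointwise by continuity of `a`; on the right it is dominated convergence, since mollifying preserves
the bound `M`. -/
lemma sub_eq_integral_of_weak_deriv_of_mem_Ioo (ha : ContinuousOn a (Icc 0 T))
    (hb : AEStronglyMeasurable b (volume.restrict (Ioo 0 T)))
    (hM : ∀ᵐ t ∂volume.restrict (Ioo 0 T), ‖b t‖ ≤ M)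
    (h : ∀ ψ : ℝ → ℝ, ContDiff ℝ ∞ ψ → HasCompactSupport ψ → tsupport ψ ⊆ Ioo 0 T →
      ∫ t in Ioo 0 T, ((deriv ψ t : ℝ) : ℂ) * a t = -∫ t in Ioo 0 T, (ψ t : ℂ) * b t)
    {s t : ℝ} (hs : s ∈ Ioo 0 T) (ht : t ∈ Ioo 0 T) : a t - a s = ∫ τ in s..t, b τ := by
  have hst : uIcc s t ⊆ Ioo 0 T := (convex_Ioo 0 T).ordConnected.uIcc_subset hs ht
  have hM0 : 0 ≤ M := by
    have : (ae (volume.restrict (Ioo 0 T))).NeBot := by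
      rw [ae_neBot, Ne, Measure.restrict_eq_zero, Real.volume_Ioo]
      simpa using hs.1.trans hs.2
    obtain ⟨x, hx⟩ := hM.exists
    exact (norm_nonneg _).trans hx
  set f := (Ioo 0 T).indicator a with hf
  set g := (Ioo 0 T).indicator b with hg
  have hfi : LocallyIntegrable f :=
    ((integrable_indicator_iff measurableSet_Ioo).2
      (ha.integrableOn_Icc.mono_set Ioo_subset_Icc_self)).locallyIntegrable
  have hgi : LocallyIntegrable g :=
    ((integrable_indicator_iff measurableSet_Ioo).2
      (Integrable.of_bound hb M hM)).locallyIntegrable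
  have hgM : ∀ᵐ t, ‖g t‖ ≤ M := by
    filter_upwards [(ae_restrict_iff' measurableSet_Ioo).1 hM] with x hx
    by_cases hxT : x ∈ Ioo 0 T <;> simp [hg, hxT, hM0, hx]
  have hfc : ∀ x ∈ Ioo 0 T, Filter.Tendsto (fun n => mollify (bumpSeq n) f x) Filter.atTop
      (nhds (a x)) := fun x hx => by
    have h1 : ContinuousAt f x := by
      refine (ha.continuousAt (Icc_mem_nhds hx.1 hx.2)).congr ?_
      filter_upwards [Ioo_mem_nhds hx.1 hx.2] with y hy
      rw [hf, indicator_of_mem hy]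
    have h2 : f x = a x := indicator_of_mem hx a
    rw [← h2]
    exact ContDiffBump.convolution_tendsto_right (g := fun _ => f) (k := fun _ => x)
      (tendsto_bumpSeq_rOut ℝ) (Filter.Eventually.of_forall fun _ => hfi.aestronglyMeasurable)
      (h1.tendsto.comp Filter.tendsto_snd) tendsto_const_nhds
  have hweak : ∀ ψ : ℝ → ℝ, ContDiff ℝ ∞ ψ → HasCompactSupport ψ → tsupport ψ ⊆ Ioo 0 T →
      ∫ y, fderiv ℝ ψ y 1 • f y = -∫ y, ψ y • g y := fun ψ h1 h2 h3 => by
    have e : ∀ (c : ℝ → ℝ) (k : ℝ → ℂ),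
        ∫ y, c y • (Ioo 0 T).indicator k y = ∫ y in Ioo 0 T, (c y : ℂ) * k y := fun c k => by
      rw [← integral_indicator measurableSet_Ioo]
      refine integral_congr_ae (Filter.Eventually.of_forall fun y => ?_)
      by_cases hy : y ∈ Ioo 0 T <;> simp [hy]
    rw [e, e, ← h ψ h1 h2 h3]
    simp
  have hev : ∀ᶠ n : ℕ in Filter.atTop, mollify (bumpSeq n) f t - mollify (bumpSeq n) f s
      = ∫ τ in s..t, mollify (bumpSeq n) g τ := by
    -- Once the mollification radius is below `δ`, the mollified weak derivative is the true one on
    -- the whole segment.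
    obtain ⟨δ, hδ, hδs⟩ := isCompact_uIcc.exists_cthickening_subset_open isOpen_Ioo hst
    filter_upwards [(tendsto_bumpSeq_rOut ℝ).eventually_lt_const hδ] with n hn
    have hgc : Continuous (mollify (bumpSeq n) g) := (contDiff_mollify (bumpSeq n) hgi).continuous
    refine (intervalIntegral.integral_eq_sub_of_hasDerivAt (fun x hx => ?_)
      (hgc.intervalIntegrable _ _)).symm
    have h1 := ((contDiff_mollify (bumpSeq n) hfi).differentiable (by simp) x).hasDerivAt
    rwa [← fderiv_apply_one_eq_deriv, fderiv_mollify (bumpSeq n) hfi hweak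
      ((Metric.closedBall_subset_closedBall hn.le).trans
        ((Metric.closedBall_subset_cthickening hx δ).trans hδs))] at h1
  have hlim := intervalIntegral.tendsto_integral_filter_of_dominated_convergence (a := s) (b := t)
    (μ := volume) (l := Filter.atTop) (F := fun n : ℕ => mollify (bumpSeq n) g) (f := g)
    (fun _ => M)
    (Filter.Eventually.of_forall fun n =>
      (contDiff_mollify (bumpSeq n) hgi).continuous.aestronglyMeasurable)
    (Filter.Eventually.of_forall fun n => Filter.Eventually.of_forall fun x _ =>
      norm_mollify_le (bumpSeq n) hgM x)
    intervalIntegrable_const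
    ((ae_tendsto_mollify_bumpSeq hgi).mono fun x hx _ => hx)
  have := tendsto_nhds_unique (((hfc t ht).sub (hfc s hs)).congr' hev) hlim
  rw [this]
  exact intervalIntegral.integral_congr fun x hx => indicator_of_mem (hst hx) b

/-- A continuous function on `[0, T]` with a bounded weak derivative is the primitive of this
derivative. -/
lemma sub_eq_integral_of_weak_deriv (hT : 0 < T) (ha : ContinuousOn a (Icc 0 T))
    (hb : AEStronglyMeasurable b (volume.restrict (Ioo 0 T)))
    (hM : ∀ᵐ t ∂volume.restrict (Ioo 0 T), ‖b t‖ ≤ M)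
    (h : ∀ ψ : ℝ → ℝ, ContDiff ℝ ∞ ψ → HasCompactSupport ψ → tsupport ψ ⊆ Ioo 0 T →
      ∫ t in Ioo 0 T, ((deriv ψ t : ℝ) : ℂ) * a t = -∫ t in Ioo 0 T, (ψ t : ℂ) * b t)
    {s t : ℝ} (hs : s ∈ Icc 0 T) (ht : t ∈ Icc 0 T) : a t - a s = ∫ τ in s..t, b τ := by
  have hbi : IntegrableOn b (Icc 0 T) :=
    (integrableOn_Icc_iff_integrableOn_Ioo (by simp) (by simp)).2 (Integrable.of_bound hb M hM)
  have hsub : ∀ x ∈ Icc 0 T, ∀ y ∈ Icc 0 T, IntervalIntegrable b volume x y := fun x hx y hy =>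
    (hbi.mono_set (uIcc_subset_Icc hx hy)).intervalIntegrable
  have h0 : (0 : ℝ) ∈ Icc 0 T := left_mem_Icc.2 hT.le
  have hm : T / 2 ∈ Ioo 0 T := ⟨half_pos hT, half_lt_self hT⟩
  have hc : ContinuousOn (fun x => a x - ∫ τ in (0 : ℝ)..x, b τ) (Icc 0 T) := by
    refine ha.sub ?_
    have := intervalIntegral.continuousOn_primitive_interval (a := 0) (b := T) (μ := volume)
      (f := b) (by rwa [uIcc_of_le hT.le])
    rwa [uIcc_of_le hT.le] at this
  -- The difference of `a` and the primitive of `b` is constant on the open interval; by continuity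
  -- this extends to the endpoints.
  have heq : EqOn (fun x => a x - ∫ τ in (0 : ℝ)..x, b τ)
      (fun _ => a (T / 2) - ∫ τ in (0 : ℝ)..(T / 2), b τ) (Ioo 0 T) := fun x hx => by
    have h1 := sub_eq_integral_of_weak_deriv_of_mem_Ioo ha hb hM h hm hx
    have h2 := intervalIntegral.integral_add_adjacent_intervals
      (hsub _ h0 _ (Ioo_subset_Icc_self hm))
      (hsub _ (Ioo_subset_Icc_self hm) _ (Ioo_subset_Icc_self hx))
    simp only
    rw [← h2, ← h1]
    ring
  have hEq := heq.of_subset_closure hc continuousOn_const Ioo_subset_Icc_self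
    (by rw [closure_Ioo hT.ne])
  have h1 := (hEq ht).trans (hEq hs).symm
  rw [← intervalIntegral.integral_interval_sub_left (hsub _ h0 _ ht) (hsub _ h0 _ hs)]
  simp only at h1
  linear_combination h1

end WeakDerivative

/-! ### Weak gradients in `H¹₀` and `H²`, and consequences of the regularity assumption. -/

section Spaces

variable {d : ℕ} {D : Set (E d)}

lemma IsConvexPolyhedron.isOpen (h : IsConvexPolyhedron D) : IsOpen D := by
  obtain ⟨-, s, -, rfl⟩ := h
  exact isOpen_interior

lemma IsConvexPolyhedron.convex (h : IsConvexPolyhedron D) : Convex ℝ D := by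
  obtain ⟨-, s, -, rfl⟩ := h
  exact (convex_convexHull ℝ s).interior

lemma IsConvexPolyhedron.isBounded (h : IsConvexPolyhedron D) : Bornology.IsBounded D := by
  obtain ⟨-, s, hs, rfl⟩ := h
  exact (isBounded_convexHull.2 hs.isBounded).subset interior_subset

lemma continuous_setIntegral_mul {k : E d → ℂ} (hk : MemLp k 2 (volume.restrict D)) :
    Continuous fun f : L2 D => ∫ x in D, f x * k x := by
  have hk' : MemLp (fun x => conj (k x)) 2 (volume.restrict D) := hk.star
  have h : (fun f : L2 D => ∫ x in D, f x * k x) = fun f => inner ℂ (hk'.toLp) f := by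
    funext f
    rw [L2.inner_def]
    refine integral_congr_ae ?_
    filter_upwards [hk'.coeFn_toLp] with x hx
    rw [hx, RCLike.inner_apply, Complex.conj_conj]
  rw [h]
  fun_prop

lemma isClosed_setOf_isWeakPDeriv (i : Fin d) :
    IsClosed {p : Jet1 D | IsWeakPDeriv D i p.fst (p.snd i)} := by
  simp only [IsWeakPDeriv, ofPred_forall]
  refine isClosed_iInter fun φ => isClosed_iInter fun hφ => isClosed_eq ?_ ?_
  · exact (continuous_setIntegral_mul (hφ.memLp_pderiv i)).comp (by fun_prop)
  · exact ((continuous_setIntegral_mul hφ.memLp).comp (by fun_prop)).neg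

lemma IsTest.integral_mul_pderiv {φ ψ : E d → ℂ} (hφ : IsTest D φ) (hψ : IsTest D ψ) (i : Fin d) :
    ∫ x in D, φ x * pderiv i ψ x = -∫ x in D, pderiv i φ x * ψ x := by
  have hφ0 : ∀ x, x ∉ D → φ x = 0 := fun x hx => image_eq_zero_of_notMem_tsupport
    fun h => hx (hφ.supp h)
  have hψ0 : ∀ x, x ∉ D → ψ x = 0 := fun x hx => image_eq_zero_of_notMem_tsupport
    fun h => hx (hψ.supp h)
  rw [setIntegral_eq_integral_of_forall_compl_eq_zero fun x hx => by rw [hφ0 x hx, zero_mul],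
    setIntegral_eq_integral_of_forall_compl_eq_zero fun x hx => by rw [hψ0 x hx, mul_zero]]
  have hφc : Continuous (pderiv i φ) :=
    (hφ.smooth.continuous_fderiv (by simp)).clm_apply continuous_const
  have hψc : Continuous (pderiv i ψ) :=
    (hψ.smooth.continuous_fderiv (by simp)).clm_apply continuous_const
  refine integral_mul_fderiv_eq_neg_fderiv_mul_of_integrable ?_ ?_ ?_
    (fun x _ => hφ.smooth.differentiable (by simp) x) (fun x _ => hψ.smooth.differentiable (by simp) x)
  · exact (hφc.mul hψ.smooth.continuous).integrable_of_hasCompactSupport hψ.compact.mul_left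
  · exact (hφ.smooth.continuous.mul hψc).integrable_of_hasCompactSupport hφ.compact.mul_right
  · exact (hφ.smooth.continuous.mul hψ.smooth.continuous).integrable_of_hasCompactSupport
      hφ.compact.mul_right

/-- The gradient of an element of `H¹₀(D)` is the weak gradient of its function. -/
lemma H10.isWeakPDeriv (u : H10 D) (i : Fin d) : IsWeakPDeriv D i u.fn (u.grad i) := by
  have hsub : (testPairs D : Set (Jet1 D)) ⊆ {p | IsWeakPDeriv D i p.fst (p.snd i)} := by
    rintro p ⟨φ, hφ, h1, h2⟩ ψ hψ
    have e1 : ∫ x in D, p.fst x * pderiv i ψ x = ∫ x in D, φ x * pderiv i ψ x :=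
      integral_congr_ae (h1.mul (Filter.EventuallyEq.refl _ _))
    have e2 : ∫ x in D, p.snd i x * ψ x = ∫ x in D, pderiv i φ x * ψ x :=
      integral_congr_ae ((h2 i).mul (Filter.EventuallyEq.refl _ _))
    rw [e1, e2, hφ.integral_mul_pderiv hψ]
  have hu : H10.incl D u ∈ closure (testPairs D : Set (Jet1 D)) := Subtype.property u
  exact closure_minimal hsub (isClosed_setOf_isWeakPDeriv i) hu

/-- The fundamental lemma of the calculus of variations, applied to `g - g'` extended by zero. -/
lemma IsWeakPDeriv.unique (hD : IsOpen D) {i : Fin d} {f g g' : L2 D}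
    (h : IsWeakPDeriv D i f g) (h' : IsWeakPDeriv D i f g') : g = g' := by
  have hm := hD.measurableSet
  rw [← sub_eq_zero]
  refine Lp.ext ?_
  have hz := hD.ae_eq_zero_of_integral_contDiff_smul_eq_zero (μ := volume)
    (f := D.indicator ((g - g' : L2 D) : E d → ℂ))
    ((locallyIntegrable_indicator_coe hm _).locallyIntegrableOn _) fun ψ h1 h2 h3 => by
      have e1 := h.integral_fderiv_smul hm ψ h1 h2 h3
      have e2 := h'.integral_fderiv_smul hm ψ h1 h2 h3
      have hi : ∀ k : L2 D, Integrable fun y => ψ y • D.indicator (k : E d → ℂ) y := fun k =>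
        (locallyIntegrable_indicator_coe hm k).integrable_smul_left_of_hasCompactSupport
          h1.continuous h2
      have e3 : ∫ y, ψ y • D.indicator ((g - g' : L2 D) : E d → ℂ) y
          = ∫ y, (ψ y • D.indicator (g : E d → ℂ) y - ψ y • D.indicator (g' : E d → ℂ) y) := by
        refine integral_congr_ae ?_
        filter_upwards [(ae_restrict_iff' hm).1 (Lp.coeFn_sub g g')] with x hx
        by_cases hxD : x ∈ D
        · rw [indicator_of_mem hxD, indicator_of_mem hxD, indicator_of_mem hxD, hx hxD,
            Pi.sub_apply, smul_sub]
        · simp [hxD]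
      rw [e3, integral_sub (hi g) (hi g')]
      linear_combination e1 - e2
  rw [Filter.EventuallyEq, ae_restrict_iff' hm]
  filter_upwards [hz, (ae_restrict_iff' hm).1 (Lp.coeFn_zero ℂ 2 (volume.restrict D))]
    with x hx h0 hxD
  rw [h0 hxD]
  simpa [hxD] using hx hxD

lemma H10.ext_fn (hD : IsOpen D) {u w : H10 D} (h : u.fn = w.fn) : u = w := by
  have hg : ∀ i, u.grad i = w.grad i := fun i =>
    (u.isWeakPDeriv i).unique hD (h ▸ w.isWeakPDeriv i)
  refine Subtype.ext ((WithLp.ext_iff 2).2 (Prod.ext h ?_))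
  exact (WithLp.ext_iff 2).2 (funext hg)

/-- The two elements each carry their own gradient; uniqueness of weak derivatives identifies them.
-/
lemma H2.incl_fst_eq (hD : IsOpen D) {v : H2 D} {u : H10 D} (h : v.fn = u.fn) :
    (H2.incl D v).fst = H10.incl D u := by
  have hv : H2.incl D v ∈ weakJets D := Subtype.property v
  refine (WithLp.ext_iff 2).2 (Prod.ext h ((WithLp.ext_iff 2).2 (funext fun i => ?_)))
  exact (hv.1 i).unique hD (show IsWeakPDeriv D i (H2.incl D v).fst.fst _ from
    (show (H2.incl D v).fst.fst = u.fn from h) ▸ u.isWeakPDeriv i)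

/-- The `H²` norm controls the `H¹` norm, and `H10 D` has the topology induced from `Jet1 D`. The
continuity holds for `u` itself at every time, not just for an almost everywhere representative. -/
lemma IsRegular.continuousOn (hD : IsOpen D) {T : ℝ} {u : ℝ → H10 D} (h : IsRegular T u) :
    ContinuousOn u (Icc 0 T) := by
  obtain ⟨v, hv, hvu⟩ := h.contH2
  have h1 : ContinuousOn (fun t => H10.incl D (u t)) (Icc 0 T) := by
    have h2 : ContinuousOn (fun t => (H2.incl D (v t)).fst) (Icc 0 T) := by
      have hc : Continuous fun w : H2 D => (H2.incl D w).fst :=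
        (WithLp.continuous_fst 2 _ _).comp (H2.incl D).continuous
      exact hc.comp_continuousOn hv
    exact h2.congr fun t ht => (H2.incl_fst_eq hD (hvu t ht)).symm
  have hi : Topology.IsInducing (H10.incl D) := Topology.IsInducing.subtypeVal
  exact hi.continuousOn_iff.2 h1

lemma IsRegular.exists_ae_norm_le (hd : d ≤ 3) (hD : IsConvexPolyhedron D) {T : ℝ}
    {u : ℝ → H10 D} (h : IsRegular T u) :
    ∃ M : ℝ, 0 ≤ M ∧ ∀ t ∈ Icc 0 T, ∀ᵐ x ∂volume.restrict D, ‖(u t).fn x‖ ≤ M := by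
  obtain ⟨C, hC, hS⟩ := exists_ae_norm_le_of_mem_weakJets hd hD.isOpen hD.convex hD.isBounded hD.1
  obtain ⟨v, hv, hvu⟩ := h.contH2
  obtain ⟨R, hR⟩ := isCompact_Icc.exists_bound_of_continuousOn
    ((H2.incl D).continuous.comp_continuousOn hv)
  -- `R` may be negative when `Icc 0 T` is empty, hence the maximum with 0.
  refine ⟨C * max R 0, by positivity, fun t ht => ?_⟩
  filter_upwards [hS (H2.incl D (v t)) (Subtype.property (v t))] with x hx
  rw [← hvu t ht]
  refine hx.trans (mul_le_mul_of_nonneg_left ((hR t ht).trans (le_max_left _ _)) hC)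

end Spaces

/-! ### Energy estimate and Gronwall argument. -/

section Energy

variable {d : ℕ} {D : Set (E d)}

lemma H10.continuous_toHm1 : Continuous (H10.toHm1 : H10 D → Hm1 D) := by
  have h : Continuous fun u : H10 D => innerSLFlip ℂ (H10.toL2 D u) :=
    (innerSLFlip ℂ).continuous.comp (H10.toL2 D).continuous
  exact ((ContinuousLinearMap.compSL (H10 D) (L2 D) ℂ (RingHom.id ℂ) (starRingEnd ℂ)).flip
    (H10.toL2 D)).continuous.comp h

lemma H10.toHm1_pair_eq_inner (u w : H10 D) : Hm1.pair w u.toHm1 = inner ℂ w.fn u.fn := rfl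

lemma Hm1.norm_pair_le (f : Hm1 D) (w : H10 D) : ‖Hm1.pair w f‖ ≤ ‖f‖ * ‖w‖ :=
  ContinuousLinearMap.le_opNorm (f : H10 D →L⋆[ℂ] ℂ) w

lemma Hm1.pair_add (f : Hm1 D) (w z : H10 D) :
    Hm1.pair (w + z) f = Hm1.pair w f + Hm1.pair z f :=
  map_add (show H10 D →L⋆[ℂ] ℂ from f) w z

/-- Pairing with a fixed `w` commutes with the integrals, which reduces the `H⁻¹`-valued statement
to the scalar one; the bound on the scalar derivative is the essential supremum of `‖u'‖` times
`‖w‖`. -/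
lemma IsWeakTimeDeriv.sub_eq_integral {T : ℝ} (hT : 0 < T) {u : ℝ → H10 D} {u' : ℝ → Hm1 D}
    (h : IsWeakTimeDeriv T u u') (hu : ContinuousOn u (Icc 0 T))
    (hu' : MemLp u' ⊤ (volume.restrict (Icc 0 T))) (w : H10 D) {s t : ℝ} (hs : s ∈ Icc 0 T)
    (ht : t ∈ Icc 0 T) :
    Hm1.pair w (u t).toHm1 - Hm1.pair w (u s).toHm1 = ∫ τ in s..t, Hm1.pair w (u' τ) := by
  have hu'o : MemLp u' ⊤ (volume.restrict (Ioo 0 T)) :=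
    hu'.mono_measure (Measure.restrict_mono_set _ Ioo_subset_Icc_self)
  have hcu : ContinuousOn (fun t => (u t).toHm1) (Icc 0 T) :=
    H10.continuous_toHm1.comp_continuousOn hu
  refine sub_eq_integral_of_weak_deriv (a := fun t => Hm1.pair w (u t).toHm1)
    (M := (eLpNorm u' ⊤ (volume.restrict (Ioo 0 T))).toReal * ‖w‖) hT
    ((Hm1.pair w).continuous.comp_continuousOn hcu)
    ((Hm1.pair w).continuous.comp_aestronglyMeasurable hu'o.1) ?_ (fun ψ h1 h2 h3 => ?_) hs ht
  · filter_upwards [ae_le_eLpNormEssSup (f := u') (μ := volume.restrict (Ioo 0 T))] with τ hτ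
    refine (Hm1.norm_pair_le _ w).trans (mul_le_mul_of_nonneg_right ?_ (norm_nonneg _))
    rw [← eLpNorm_exponent_top] at hτ
    rw [← toReal_enorm]
    exact ENNReal.toReal_mono hu'o.2.ne hτ
  · have key := congrArg (Hm1.pair w) (h _ (isTest_ofReal h1 h2 h3))
    have hd : ∀ t, deriv (fun x => (ψ x : ℂ)) t = ((deriv ψ t : ℝ) : ℂ) := fun t =>
      ((h1.differentiable (by simp) t).hasDerivAt.ofReal_comp).deriv
    have hdc : Continuous fun t => ((deriv ψ t : ℝ) : ℂ) :=
      Complex.continuous_ofReal.comp (h1.continuous_deriv (by simp))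
    have hψc : Continuous fun t => (ψ t : ℂ) := Complex.continuous_ofReal.comp h1.continuous
    have hi1 : IntegrableOn (fun t => ((deriv ψ t : ℝ) : ℂ) • (u t).toHm1) (Ioo 0 T) :=
      ((hdc.continuousOn.smul hcu).integrableOn_Icc).mono_set Ioo_subset_Icc_self
    have hi2 : IntegrableOn (fun t => (ψ t : ℂ) • u' t) (Ioo 0 T) := by
      obtain ⟨K, hK⟩ := h2.exists_bound_of_continuous h1.continuous
      refine (hu'o.integrable le_top).bdd_smul K hψc.aestronglyMeasurable
        (Filter.Eventually.of_forall fun t => ?_)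
      simpa using hK t
    simp only [hd] at key
    rw [map_neg, ← ContinuousLinearMap.integral_comp_comm _ hi1,
      ← ContinuousLinearMap.integral_comp_comm _ hi2] at key
    simpa only [map_smul, smul_eq_mul] using key

lemma integral_mul_conj_self_im (f : E d → ℂ) : (∫ x in D, f x * conj (f x)).im = 0 := by
  have : ∀ x, f x * conj (f x) = ((Complex.normSq (f x) : ℝ) : ℂ) := fun x => Complex.mul_conj _
  simp only [this]
  rw [integral_complex_ofReal, Complex.ofReal_im]

lemma integral_ofReal_mul_conj_self_im (V : E d → ℝ) (f : E d → ℂ) :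
    (∫ x in D, (V x : ℂ) * f x * conj (f x)).im = 0 := by
  have : ∀ x, (V x : ℂ) * f x * conj (f x) = ((V x * Complex.normSq (f x) : ℝ) : ℂ) := fun x => by
    rw [mul_assoc, Complex.mul_conj, Complex.ofReal_mul]
  simp only [this]
  rw [integral_complex_ofReal, Complex.ofReal_im]

lemma integral_norm_sq_eq (f : L2 D) : ∫ x in D, ‖f x‖ ^ 2 = ‖f‖ ^ 2 := by
  have h : inner ℂ f f = ((∫ x in D, ‖f x‖ ^ 2 : ℝ) : ℂ) := by
    rw [L2.inner_def, ← integral_complex_ofReal]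
    refine integral_congr_ae (Filter.Eventually.of_forall fun x => ?_)
    simp [inner_self_eq_norm_sq_to_K]
  rw [inner_self_eq_norm_sq_to_K] at h
  have h' : (‖f‖ : ℂ) ^ 2 = ((∫ x in D, ‖f x‖ ^ 2 : ℝ) : ℂ) := h
  exact_mod_cast h'.symm

/-- Testing the difference of two equations with the difference of the solutions. -/
lemma abs_re_pair_sub_le {V : E d → ℝ} (hV : MemLp V ⊤ (volume.restrict D)) {γ : ℝ → ℝ}
    (hγ : ContinuousOn γ (Ici 0)) {M K : ℝ} (hM : 0 ≤ M)
    (hK : ∀ v w : ℂ, ‖v‖ ≤ M → ‖w‖ ≤ M →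
      ‖(γ (‖v‖ ^ 2) : ℂ) * v - (γ (‖w‖ ^ 2) : ℂ) * w‖ ≤ K * ‖v - w‖)
    {u₁ u₂ : H10 D} (b₁ : ∀ᵐ x ∂volume.restrict D, ‖u₁.fn x‖ ≤ M)
    (b₂ : ∀ᵐ x ∂volume.restrict D, ‖u₂.fn x‖ ≤ M) {f₁ f₂ : Hm1 D}
    (e₁ : ∀ w : H10 D, Complex.I * Hm1.pair w f₁
        = (∑ i, ∫ x in D, u₁.grad i x * conj (w.grad i x))
          + (∫ x in D, (V x : ℂ) * u₁.fn x * conj (w.fn x))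
          + ∫ x in D, (γ (‖u₁.fn x‖ ^ 2) : ℂ) * u₁.fn x * conj (w.fn x))
    (e₂ : ∀ w : H10 D, Complex.I * Hm1.pair w f₂
        = (∑ i, ∫ x in D, u₂.grad i x * conj (w.grad i x))
          + (∫ x in D, (V x : ℂ) * u₂.fn x * conj (w.fn x))
          + ∫ x in D, (γ (‖u₂.fn x‖ ^ 2) : ℂ) * u₂.fn x * conj (w.fn x)) :
    |(Hm1.pair (u₁ - u₂) (f₁ - f₂)).re| ≤ K * ‖(u₁ - u₂).fn‖ ^ 2 := by
  set z := u₁ - u₂ with hz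
  have hfn : ∀ᵐ x ∂volume.restrict D, z.fn x = u₁.fn x - u₂.fn x := Lp.coeFn_sub u₁.fn u₂.fn
  have hgr : ∀ i, ∀ᵐ x ∂volume.restrict D, z.grad i x = u₁.grad i x - u₂.grad i x := fun i =>
    Lp.coeFn_sub (u₁.grad i) (u₂.grad i)
  have hconj : ∀ f : L2 D, MemLp (fun x => conj (f x)) 2 (volume.restrict D) := fun f =>
    (Lp.memLp f).star
  have hVc : MemLp (fun x => (V x : ℂ)) ⊤ (volume.restrict D) := hV.ofReal
  have hVf : ∀ f : L2 D, MemLp (fun x => (V x : ℂ) * f x) 2 (volume.restrict D) := fun f =>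
    (Lp.memLp f).mul hVc
  have hγc : Continuous fun v : ℂ => (γ (‖v‖ ^ 2) : ℂ) * v :=
    (Complex.continuous_ofReal.comp (hγ.comp_continuous (by fun_prop)
      fun v => sq_nonneg ‖v‖)).mul continuous_id
  have hN : ∀ f : L2 D, (∀ᵐ x ∂volume.restrict D, ‖f x‖ ≤ M) →
      MemLp (fun x => (γ (‖f x‖ ^ 2) : ℂ) * f x) 2 (volume.restrict D) := fun f hf => by
    refine MemLp.of_le_mul (c := K) (Lp.memLp f)
      (hγc.comp_aestronglyMeasurable (Lp.aestronglyMeasurable f)) ?_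
    filter_upwards [hf] with x hx
    -- Comparison with 0 turns the Lipschitz bound into linear growth, so the nonlinear term is in
    -- `L²`.
    simpa using hK (f x) 0 hx (by simpa using hM)
  have s1 : ∀ i, (∫ x in D, u₁.grad i x * conj (z.grad i x))
      - (∫ x in D, u₂.grad i x * conj (z.grad i x)) = ∫ x in D, z.grad i x * conj (z.grad i x) :=
    fun i => by
      refine (integral_sub ((Lp.memLp (u₁.grad i)).integrable_mul (hconj (z.grad i)))
        ((Lp.memLp (u₂.grad i)).integrable_mul (hconj (z.grad i)))).symm.trans
        (integral_congr_ae ?_)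
      filter_upwards [hgr i] with x hx
      rw [Pi.mul_apply, Pi.mul_apply, ← sub_mul, ← hx]
  have s2 : (∫ x in D, (V x : ℂ) * u₁.fn x * conj (z.fn x))
      - (∫ x in D, (V x : ℂ) * u₂.fn x * conj (z.fn x))
      = ∫ x in D, (V x : ℂ) * z.fn x * conj (z.fn x) := by
    refine (integral_sub ((hVf u₁.fn).integrable_mul (hconj z.fn))
      ((hVf u₂.fn).integrable_mul (hconj z.fn))).symm.trans (integral_congr_ae ?_)
    filter_upwards [hfn] with x hx
    rw [Pi.mul_apply, Pi.mul_apply, ← sub_mul, ← mul_sub, ← hx]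
  have s3 := integral_sub ((hN _ b₁).integrable_mul (hconj z.fn))
    ((hN _ b₂).integrable_mul (hconj z.fn))
  set J := ∫ x in D, ((γ (‖u₁.fn x‖ ^ 2) : ℂ) * u₁.fn x * conj (z.fn x)
    - (γ (‖u₂.fn x‖ ^ 2) : ℂ) * u₂.fn x * conj (z.fn x)) with hJ
  have hmain : Complex.I * Hm1.pair z (f₁ - f₂)
      = (∑ i, ∫ x in D, z.grad i x * conj (z.grad i x))
        + (∫ x in D, (V x : ℂ) * z.fn x * conj (z.fn x)) + J := by
    rw [map_sub, mul_sub, e₁ z, e₂ z, ← s2]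
    simp only [← s1]
    rw [Finset.sum_sub_distrib]
    have s3' : J = _ - _ := s3
    rw [s3']
    simp only [Pi.mul_apply]
    ring
  -- Multiplication by `I` turns the real part into an imaginary part; the gradient and potential
  -- integrals are real, so only `J` contributes.
  have him : (Hm1.pair z (f₁ - f₂)).re = J.im := by
    have := congrArg Complex.im hmain
    rw [Complex.I_mul_im, Complex.add_im, Complex.add_im, Complex.im_sum,
      integral_ofReal_mul_conj_self_im] at this
    simpa [integral_mul_conj_self_im] using this
  rw [him, ← integral_norm_sq_eq, ← integral_const_mul]
  refine (Complex.abs_im_le_norm J).trans (norm_integral_le_of_norm_le ?_ ?_)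
  · have := ((Lp.memLp z.fn).integrable_norm_pow (by norm_num)).const_mul K
    simpa using this
  · filter_upwards [b₁, b₂, hfn] with x h1 h2 h3
    rw [← sub_mul, norm_mul, RCLike.norm_conj, pow_two ‖z.fn x‖, ← mul_assoc]
    refine mul_le_mul_of_nonneg_right ?_ (norm_nonneg _)
    rw [h3]
    exact hK _ _ h1 h2

/-- A Gronwall argument for the squared norm of a continuous curve starting at zero. -/
lemma eq_zero_of_sub_le_mul {T K N : ℝ} (hN : 0 ≤ N) {X : Type*} [NormedAddCommGroup X]
    {e : ℝ → X} {F : ℝ → ℝ} (he : ContinuousOn e (Icc 0 T)) (hF : ContinuousOn F (Icc 0 T))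
    (hF0 : F 0 = 0) (hFnn : ∀ t, 0 ≤ F t)
    (h : ∀ s t c, s ∈ Icc 0 T → t ∈ Icc 0 T → s < t →
      (∀ τ ∈ Icc s t, K * F τ + N * ‖e t + e s - (e τ + e τ)‖ ≤ c) → F t - F s ≤ (t - s) * c) :
    ∀ t ∈ Icc 0 T, F t = 0 := by
  -- As `t` decreases to `s` the `N`-term vanishes by continuity of `e`, so the right difference
  -- quotients of `F` are eventually below any `r > K * F s`. Zero initial value and zero forcing
  -- make the Gronwall bound 0.
  have hG := le_gronwallBound_of_liminf_deriv_right_le (f := F) (f' := fun t => K * F t) (δ := 0)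
    (K := K) (ε := 0) (a := 0) (b := T) hF (fun x hx r hr => ?_) hF0.le (fun x _ => by simp)
  · intro t ht
    refine le_antisymm ?_ (hFnn t)
    simpa [gronwallBound_ε0_δ0] using hG t ht
  · have hxI : x ∈ Icc 0 T := ⟨hx.1, hx.2.le⟩
    -- This `η` places `K * F x + (1 + 3N) η` midway between `K * F x` and `r`. The 3 comes from `e
    -- z + e x - 2 e τ = (e z - e x) - 2 (e τ - e x)`.
    obtain ⟨η, hη, hηr⟩ : ∃ η : ℝ, 0 < η ∧ K * F x + η + N * (3 * η) < r := by
      refine ⟨(r - K * F x) / (2 * (1 + 3 * N)), by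
        have : 0 < r - K * F x := sub_pos.2 hr
        positivity, ?_⟩
      have h1 : (r - K * F x) / (2 * (1 + 3 * N)) * (1 + 3 * N) = (r - K * F x) / 2 := by
        field_simp
      have hr' : K * F x < r := hr
      linarith
    have h1 := (he x hxI).eventually (Metric.ball_mem_nhds _ hη)
    have h2 := ((hF.const_smul K) x hxI).eventually (gt_mem_nhds (lt_add_of_pos_right _ hη))
    obtain ⟨δ, hδ, hδ'⟩ := Metric.mem_nhdsWithin_iff.1 (h1.and h2)
    refine Filter.Eventually.frequently ?_
    filter_upwards [Ioo_mem_nhdsGT (lt_min (lt_add_of_pos_right x hδ) hx.2)] with z hz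
    have hzT : z < T := hz.2.trans_le (min_le_right _ _)
    have hzδ : z < x + δ := hz.2.trans_le (min_le_left _ _)
    have hpos : 0 < z - x := sub_pos.2 hz.1
    have hτ : ∀ τ ∈ Icc x z, ‖e τ - e x‖ < η ∧ K * F τ < K * F x + η := fun τ hτ => by
      have := hδ' (show τ ∈ Metric.ball x δ ∩ Icc 0 T from
        ⟨by rw [Metric.mem_ball, Real.dist_eq, abs_of_nonneg (by linarith [hτ.1])]
            linarith [hτ.2], hx.1.trans hτ.1, hτ.2.trans hzT.le⟩)
      exact ⟨by simpa [dist_eq_norm] using this.1, this.2⟩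
    have hb := h x z (K * F x + η + N * (3 * η)) hxI ⟨hx.1.trans hz.1.le, hzT.le⟩ hz.1
      fun τ hτ' => by
        have e1 := (hτ z ⟨hz.1.le, le_rfl⟩).1
        have e2 := hτ τ hτ'
        have e3 : ‖e z + e x - (e τ + e τ)‖ ≤ 3 * η := by
          have : e z + e x - (e τ + e τ) = (e z - e x) - (e τ - e x) - (e τ - e x) := by abel
          rw [this]
          linarith [norm_sub_le ((e z - e x) - (e τ - e x)) (e τ - e x),
            norm_sub_le (e z - e x) (e τ - e x), e2.1]
        have := mul_le_mul_of_nonneg_left e3 hN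
        linarith [e2.2]
    rw [inv_mul_lt_iff₀ hpos]
    exact hb.trans_lt (mul_lt_mul_of_pos_left hηr hpos)

/-- The initial value is prescribed for a continuous representative; two continuous functions that
agree almost everywhere on `[0,T]` agree at 0 too. -/
lemma IsSolution.fn_zero {V : E d → ℝ} {γ : ℝ → ℝ} {T : ℝ} (hT : 0 < T) {u0 : H10 D}
    {u : ℝ → H10 D} (h : IsSolution D V γ T u0 u) (hu : ContinuousOn u (Icc 0 T)) :
    (u 0).fn = u0.fn := by
  obtain ⟨c, hc, hcu, hc0⟩ := h.initial
  have hfn : ContinuousOn (fun t => (u t).fn) (Icc 0 T) :=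
    (H10.toL2 D).continuous.comp_continuousOn hu
  have heq := Measure.eqOn_Icc_of_ae_eq volume hT.ne hcu hc hfn
  rw [← hc0]
  exact (heq (left_mem_Icc.2 hT.le)).symm

end Energy

end NLS

/-! ### Uniqueness. -/

open NLS in
theorem lemma3p1 (d : ℕ) (hd : d = 2 ∨ d = 3) (D : Set (NLS.E d)) (hD : NLS.IsConvexPolyhedron D)
    (V : NLS.E d → ℝ) (hV : MemLp V ⊤ (volume.restrict D))
    (hV0 : ∀ᵐ x ∂volume.restrict D, 0 ≤ V x)
    (γ : ℝ → ℝ) (hγ : NLS.IsAdmissibleNonlinearity d γ)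
    (T : ℝ) (hT : 0 < T) (u0 : NLS.H10 D) (u₁ u₂ : ℝ → NLS.H10 D)
    (h₁ : NLS.IsSolution D V γ T u0 u₁) (h₂ : NLS.IsSolution D V γ T u0 u₂)
    (r₁ : NLS.IsRegular T u₁) (r₂ : NLS.IsRegular T u₂) :
    ∀ t ∈ Icc 0 T, u₁ t = u₂ t := by
  have hd3 : d ≤ 3 := by omega
  have c₁ := r₁.continuousOn hD.isOpen
  have c₂ := r₂.continuousOn hD.isOpen
  obtain ⟨M₁, hM₁, b₁⟩ := r₁.exists_ae_norm_le hd3 hD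
  obtain ⟨M₂, hM₂, b₂⟩ := r₂.exists_ae_norm_le hd3 hD
  obtain ⟨L, -, -, -, -, -, hL⟩ := hγ.growth
  obtain ⟨f₁, hf₁, w₁, e₁⟩ := h₁.equation
  obtain ⟨f₂, hf₂, w₂, e₂⟩ := h₂.equation
  set N := (eLpNorm (f₁ - f₂) ⊤ (volume.restrict (Icc 0 T))).toReal with hN
  have hf : MemLp (f₁ - f₂) ⊤ (volume.restrict (Icc 0 T)) := hf₁.sub hf₂
  have hfN : ∀ᵐ τ ∂volume.restrict (Icc 0 T), ‖f₁ τ - f₂ τ‖ ≤ N := by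
    filter_upwards [ae_le_eLpNormEssSup (f := f₁ - f₂) (μ := volume.restrict (Icc 0 T))] with τ hτ
    rw [← eLpNorm_exponent_top] at hτ
    rw [← toReal_enorm]
    exact ENNReal.toReal_mono hf.2.ne hτ
  set e : ℝ → H10 D := fun t => u₁ t - u₂ t with he
  have hec : ContinuousOn e (Icc 0 T) := c₁.sub c₂
  have hen : ContinuousOn (fun t => ‖(e t).fn‖ ^ 2) (Icc 0 T) :=
    (((H10.toL2 D).continuous.comp_continuousOn hec).norm.pow 2)
  -- Split `w = (w - 2 e τ) + 2 e τ`: the second part gives the energy estimate twice, the first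
  -- costs at most `N` times its norm. The exceptional null set does not depend on `w`, so `w` may
  -- later be chosen as `e t + e s`.
  have hpt : ∀ᵐ τ ∂volume.restrict (Icc 0 T), ∀ w : H10 D, (Hm1.pair w (f₁ τ - f₂ τ)).re
      ≤ 2 * L (max M₁ M₂) * ‖(e τ).fn‖ ^ 2 + N * ‖w - (e τ + e τ)‖ := by
    filter_upwards [e₁, e₂, hfN, ae_restrict_mem measurableSet_Icc] with τ q₁ q₂ hτ hτT w
    have k1 := abs_re_pair_sub_le hV hγ.smooth.continuousOn (le_max_of_le_left hM₁)
      (hL (max M₁ M₂)) ((b₁ τ hτT).mono fun x hx => hx.trans (le_max_left _ _))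
      ((b₂ τ hτT).mono fun x hx => hx.trans (le_max_right _ _)) q₁ q₂
    have k2 : (Hm1.pair (w - (e τ + e τ)) (f₁ τ - f₂ τ)).re ≤ N * ‖w - (e τ + e τ)‖ :=
      (Complex.re_le_norm _).trans ((Hm1.norm_pair_le _ _).trans
        (mul_le_mul_of_nonneg_right hτ (norm_nonneg _)))
    have k3 : Hm1.pair w (f₁ τ - f₂ τ) = Hm1.pair (w - (e τ + e τ)) (f₁ τ - f₂ τ)
        + (Hm1.pair (e τ) (f₁ τ - f₂ τ) + Hm1.pair (e τ) (f₁ τ - f₂ τ)) := by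
      rw [← Hm1.pair_add, ← Hm1.pair_add, sub_add_cancel]
    rw [k3, Complex.add_re, Complex.add_re]
    linarith [(abs_le.1 k1).2]
  have hint : ∀ f : ℝ → Hm1 D, MemLp f ⊤ (volume.restrict (Icc 0 T)) → ∀ w : H10 D,
      ∀ s ∈ Icc 0 T, ∀ t ∈ Icc 0 T,
      IntervalIntegrable (fun τ => Hm1.pair w (f τ)) volume s t := fun f hf w s hs t ht => by
    have : IntegrableOn (fun τ => Hm1.pair w (f τ)) (Icc 0 T) :=
      (Hm1.pair w).integrable_comp (hf.integrable le_top)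
    exact (this.mono_set (uIcc_subset_Icc hs ht)).intervalIntegrable
  have hzero := eq_zero_of_sub_le_mul (T := T) (K := 2 * L (max M₁ M₂)) (N := N)
    ENNReal.toReal_nonneg hec hen ?_ (fun t => sq_nonneg _) ?_
  · intro t ht
    have h0 : (u₁ t).fn - (u₂ t).fn = 0 := by
      have := hzero t ht
      exact norm_eq_zero.1 (pow_eq_zero_iff two_ne_zero |>.1 this)
    exact H10.ext_fn hD.isOpen (sub_eq_zero.1 h0)
  · have h0 : (e 0).fn = (u₁ 0).fn - (u₂ 0).fn := rfl
    rw [h0, h₁.fn_zero hT c₁, h₂.fn_zero hT c₂]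
    simp
  · intro s t c hs ht hst hc
    set w := e t + e s with hw
    have hi1 : IntervalIntegrable (fun τ => Hm1.pair w (f₁ τ - f₂ τ)) volume s t :=
      hint _ hf w s hs t ht
    have hid : ∫ τ in s..t, Hm1.pair w (f₁ τ - f₂ τ)
        = inner ℂ ((e t).fn + (e s).fn) ((e t).fn - (e s).fn) := by
      have a1 := w₁.sub_eq_integral hT c₁ hf₁ w hs ht
      have a2 := w₂.sub_eq_integral hT c₂ hf₂ w hs ht
      simp only [map_sub]
      rw [intervalIntegral.integral_sub (hint f₁ hf₁ w s hs t ht)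
        (hint f₂ hf₂ w s hs t ht), ← a1, ← a2]
      simp only [H10.toHm1_pair_eq_inner, ← inner_sub_right]
      change inner ℂ ((e t).fn + (e s).fn) _ = inner ℂ ((e t).fn + (e s).fn)
        (((u₁ t).fn - (u₂ t).fn) - ((u₁ s).fn - (u₂ s).fn))
      congr 1
      abel
    -- The cross terms are complex conjugates with opposite signs, so they cancel in the real part.
    have hre : ‖(e t).fn‖ ^ 2 - ‖(e s).fn‖ ^ 2
        = (inner ℂ ((e t).fn + (e s).fn) ((e t).fn - (e s).fn)).re := by
      have hsymm : (inner ℂ (e s).fn (e t).fn).re = (inner ℂ (e t).fn (e s).fn).re := by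
        rw [← inner_conj_symm, Complex.conj_re]
      rw [inner_sub_right, inner_add_left, inner_add_left, inner_self_eq_norm_sq_to_K,
        inner_self_eq_norm_sq_to_K]
      simp [← Complex.ofReal_pow, hsymm]
      ring
    have hbound : ∀ᵐ τ ∂volume.restrict (Icc s t), (Hm1.pair w (f₁ τ - f₂ τ)).re ≤ c := by
      filter_upwards [ae_restrict_of_ae_restrict_of_subset (Icc_subset_Icc hs.1 ht.2) hpt,
        ae_restrict_mem measurableSet_Icc] with τ hτ hτs
      exact (hτ w).trans (hc τ hτs)
    have hreint : (∫ τ in s..t, Hm1.pair w (f₁ τ - f₂ τ)).re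
        = ∫ τ in s..t, (Hm1.pair w (f₁ τ - f₂ τ)).re :=
      (Complex.reCLM.intervalIntegral_comp_comm hi1).symm
    rw [hre, ← hid, hreint]
    have hi2 : IntervalIntegrable (fun τ => (Hm1.pair w (f₁ τ - f₂ τ)).re) volume s t :=
      ⟨hi1.1.re, hi1.2.re⟩
    refine (intervalIntegral.integral_mono_ae_restrict hst.le hi2 intervalIntegrable_const
      hbound).trans_eq ?_
    simp
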